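/- For a probability distribution $P=\langle p_1,\dots,p_n\rangle$ on $n$ symbols $a_1,\dots,a_n$, let $\mathcal L(P)$ denote the minimum of the average codeword length $\sum_i p_i\,|c_i|$ over all binary prefix codes $a_i\mapsto c_i$ (no codeword $c_i$ is a prefix of $c_j$ for $j\neq i$). Theorem. Let $c>1$ be a constant. On a word RAM with word size $w=\Omega(\log n)$, meaning $w\ge\log_2 n$ so that a symbol index fits into a word, one can store a prefix code for $P$ with average codeword length at most $c\,\mathcal L(P)$ in $O(n^{1/c}\log n)$ bits, such that any symbol can be encoded and decoded in $O(1)$ time. Precisely: there are an encoding program, a decoding program and constants $C,T,k$, all depending only on $c$, such that for all $n$, all $w$ with $2^w\ge n$ and all $P$ there are a prefix code $a_i\mapsto c_i$ with $\sum_i p_i|c_i|\le c\,\mathcal L(P)$ and $|c_i|\le k\,w$ for all $i$, and a bit string $B$ of at most $C\,n^{1/c}\log_2 n$ bits, with the following property. When $B$ is in the read-only memory of the RAM, packed into $w$-bit words, the encoding program, given the index of any symbol $a_i$, outputs $|c_i|$ and the bits of $c_i$ (in $k$ words) within $T$ steps; and the decoding program, given the first $k$ words of any bit stream that begins with some codeword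 $c_i$, outputs the index of $a_i$ and $|c_i|$ within $T$ steps. The programs use a constant number of registers; the unit-cost operations are assignments of numerals and of $w$, register copies, arithmetic modulo $2^w$ (addition, subtraction, multiplication, division, remainder), bitwise operations, shifts, memory reads, and comparisons that control branches and loops. -/

import Mathlib

namespace PrefixCodeRAM

/-! ### Prefix codes and average codeword length -/

/-- A binary prefix (instantaneous) code on the symbols `0, …, n-1`:
no codeword is a prefix of the codeword of another symbol. -/
def IsPrefixCode {n : ℕ} (code : Fin n → List Bool) : Prop :=
  ∀ i j : Fin n, i ≠ j → ¬ (code i <+: code j)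

/-- The average codeword length of a code under the weights `p`. -/
noncomputable def avgLength {n : ℕ} (p : Fin n → ℝ) (code : Fin n → List Bool) : ℝ :=
  ∑ i, p i * ((code i).length : ℝ)

/-- The optimal average codeword length over all prefix codes. -/
noncomputable def optAvgLength {n : ℕ} (p : Fin n → ℝ) : ℝ :=
  sInf {x : ℝ | ∃ code : Fin n → List Bool, IsPrefixCode code ∧ x = avgLength p code}

/-! ### Bit sequences cut into words -/

/-- A finite bit string followed by zeros. -/
def padded (l : List Bool) : ℕ → Bool := fun j => l.getD j false

/-- The `j`-th word of `w` bits of a bit sequence, i.e. bits `j*w, …, j*w + w - 1`,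
the first of them being the most significant bit of the word. -/
def packWord (w : ℕ) (s : ℕ → Bool) (j : ℕ) : BitVec w :=
  BitVec.ofFnBE fun i : Fin w => s (j * w + i)

/-! ### The word RAM

Words are `w`-bit vectors, all arithmetic is modulo `2 ^ w`. There are registers and a read-only
memory of `2 ^ w` words that is addressed by a word. A program is independent of `w`, and mentions
finitely many registers, so that its working space is a constant number of words. Every
instruction and every test takes one time step. -/

/-- The arithmetic and bitwise operations of the machine. -/
inductive BinOp
  | add | sub | mul | div | mod | and | or | xor | shl | shr

/-- Operations on words; `div` and `mod` are unsigned, shifts are logical. -/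
def BinOp.eval {w : ℕ} : BinOp → BitVec w → BitVec w → BitVec w
  | .add, x, y => x + y
  | .sub, x, y => x - y
  | .mul, x, y => x * y
  | .div, x, y => x / y
  | .mod, x, y => x % y
  | .and, x, y => x &&& y
  | .or, x, y => x ||| y
  | .xor, x, y => x ^^^ y
  | .shl, x, y => x <<< y
  | .shr, x, y => x >>> y

/-- Instructions; `d` is the target register, `s` and `t` are source registers. -/
inductive Instr
  /-- put the numeral `a` (modulo `2 ^ w`) into register `d` -/
  | const (d a : ℕ)
  /-- put the word size `w` into register `d` -/
  | wordSize (d : ℕ)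
  /-- copy register `s` to register `d` -/
  | move (d s : ℕ)
  /-- apply `o` to registers `s` and `t` -/
  | op (o : BinOp) (d s t : ℕ)
  /-- read the memory word whose address is in register `s` -/
  | load (d s : ℕ)

/-- Contents of the registers. -/
abbrev Regs (w : ℕ) := ℕ → BitVec w

/-- The effect of one instruction. -/
def Instr.eval {w : ℕ} (mem : BitVec w → BitVec w) : Instr → Regs w → Regs w
  | .const d a, r => Function.update r d (BitVec.ofNat w a)
  | .wordSize d, r => Function.update r d (BitVec.ofNat w w)
  | .move d s, r => Function.update r d (r s)
  | .op o d s t, r => Function.update r d (o.eval (r s) (r t))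
  | .load d s, r => Function.update r d (mem (r s))

/-- Tests comparing two registers (as unsigned numbers). -/
inductive Test
  | eq (s t : ℕ)
  | lt (s t : ℕ)

/-- The truth value of a test. -/
def Test.Holds {w : ℕ} : Test → Regs w → Prop
  | .eq s t, r => r s = r t
  | .lt s t, r => (r s).toNat < (r t).toNat

/-- Programs. -/
inductive Prog
  | instr (a : Instr)
  | seq (p q : Prog)
  | cond (b : Test) (p q : Prog)
  | loop (b : Test) (p : Prog)

/-- `Exec mem p r r' t`: with memory `mem` and registers `r`, the program `p` halts with
registers `r'` after exactly `t` steps. -/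
inductive Exec {w : ℕ} (mem : BitVec w → BitVec w) : Prog → Regs w → Regs w → ℕ → Prop
  | instr (a : Instr) (r : Regs w) : Exec mem (.instr a) r (a.eval mem r) 1
  | seq {p q : Prog} {r r' r'' : Regs w} {t t' : ℕ} :
      Exec mem p r r' t → Exec mem q r' r'' t' → Exec mem (.seq p q) r r'' (t + t')
  | condTrue {b : Test} {p q : Prog} {r r' : Regs w} {t : ℕ} :
      b.Holds r → Exec mem p r r' t → Exec mem (.cond b p q) r r' (t + 1)
  | condFalse {b : Test} {p q : Prog} {r r' : Regs w} {t : ℕ} :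
      ¬ b.Holds r → Exec mem q r r' t → Exec mem (.cond b p q) r r' (t + 1)
  | loopStop {b : Test} {p : Prog} {r : Regs w} :
      ¬ b.Holds r → Exec mem (.loop b p) r r 1
  | loopStep {b : Test} {p : Prog} {r r' r'' : Regs w} {t t' : ℕ} :
      b.Holds r → Exec mem p r r' t → Exec mem (.loop b p) r' r'' t' →
      Exec mem (.loop b p) r r'' (t + t' + 1)

/-! ### Encoding and decoding with a stored bit string -/

/-- The memory that holds the bit string `B`, packed into words and padded with zeros. -/
def memory (w : ℕ) (B : List Bool) : BitVec w → BitVec w :=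
  fun a => packWord w (padded B) a.toNat

/-- With the data `B` in memory, the program `enc` encodes every symbol in at most `T` steps.
The symbol is given in register `0`, all other registers are zero. At the end register `0` holds
the length of the codeword, and registers `1, …, k` hold its bits, in order and padded with
zeros; the codeword fits into these `k` words. -/
def EncodesWithin {n : ℕ} (w : ℕ) (B : List Bool) (code : Fin n → List Bool)
    (enc : Prog) (k T : ℕ) : Prop :=
  ∀ i : Fin n, (code i).length ≤ k * w ∧
    ∃ (r : Regs w) (t : ℕ), t ≤ T ∧
      Exec (memory w B) enc (fun j => if j = 0 then BitVec.ofNat w i else 0) r t ∧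
      (r 0).toNat = (code i).length ∧
      ∀ j < k, r (j + 1) = packWord w (padded (code i)) j

/-- With the data `B` in memory, the program `dec` decodes every symbol in at most `T` steps.
The input is an arbitrary bit stream `s` that starts with the codeword of some symbol; registers
`0, …, k-1` hold its first `k` words, all other registers are zero. At the end register `0`
holds the symbol and register `1` the length of its codeword. -/
def DecodesWithin {n : ℕ} (w : ℕ) (B : List Bool) (code : Fin n → List Bool)
    (dec : Prog) (k T : ℕ) : Prop :=
  ∀ (i : Fin n) (s : ℕ → Bool), (∀ j < (code i).length, s j = padded (code i) j) →
    ∃ (r : Regs w) (t : ℕ), t ≤ T ∧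
      Exec (memory w B) dec (fun j => if j < k then packWord w s j else 0) r t ∧
      (r 0).toNat = (i : ℕ) ∧ (r 1).toNat = (code i).length

end PrefixCodeRAM

/-! Start from an optimal prefix code. Let `K = ⌈1/(c-1)⌉`, let `b` be the maximum of `⌈log₂ n⌉` and
a constant, and let `t = ⌈(b+K+1)/c⌉`. A codeword longer than `t` may be replaced by an escape word
of `K+1` bits followed by the symbol in `b` bits, since `K+1+b ≤ c*t`. Room for the escape word is
made at a node `u` of depth `K` on a long codeword: a bit `true` inserted after `u` frees `u ++
[false]`. Only codewords with `l ≥ K` bits grow, by one bit, and `l+1 ≤ c*l` for these. So the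
factor `c` holds codeword by codeword (`IsPrefixCode.exists_escape`).

The codewords that are kept have at most `t+1` bits, so there are at most `2^(t+1) = O(n^(1/c))` of
them, and a table of that many fields of `b = O(log n)` bits is affordable. Decoding looks up the
first `t+1` bits of the stream. Encoding must find a symbol among the kept ones; two-level hashing
with multiply-shift functions does this in constant time and a linear number of cells
(`exists_perfectHash`). `exists_table` puts both into one array.

The programs may depend on `c` only, so they have to discover `b` in the memory. The array starts
with the fields `1, 0, b`. If three fields fit into a word, the first word is slightly above
`2^(w-b)`, and one division recovers `2^b` from it; otherwise `w < 3*b`, and a whole word spent on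
`b` costs no more than a constant number of fields (`IsFieldArray.val_fieldWidth`).

These estimates need `w` above a constant. At each of the finitely many smaller word sizes
everything is a finite function, realised by comparisons. There the memory holds only the codeword
lengths of an optimal code, which fit into words by `IsPrefixCode.length_lt_of_minimal`, and encoder
and decoder use the same choice of a code with these lengths (`exists_expr_of_wordSize`). For `n =
1` the space bound is zero, so the memory must be empty; this shows in a first word equal to zero.

The programs are written as loop-free expressions, whose compiled form runs in a time that does not
depend on `w` (`Expr.exists_prog`). -/

namespace PrefixCodeRAM

/-! ### Expressions and their compilation -/

/-- Straight-line expressions with conditionals over the registers and the memory. -/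
inductive Expr
  | reg (s : ℕ)
  | const (a : ℕ)
  | wordSize
  | op (o : BinOp) (x y : Expr)
  | load (x : Expr)
  | iteEq (x y p q : Expr)
  | iteLt (x y p q : Expr)

namespace Expr

/-- The value of an expression. -/
def eval {w : ℕ} (mem : BitVec w → BitVec w) (r : Regs w) : Expr → BitVec w
  | reg s => r s
  | const a => BitVec.ofNat w a
  | wordSize => BitVec.ofNat w w
  | op o x y => o.eval (x.eval mem r) (y.eval mem r)
  | load x => mem (x.eval mem r)
  | iteEq x y p q => if x.eval mem r = y.eval mem r then p.eval mem r else q.eval mem r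
  | iteLt x y p q =>
      if (x.eval mem r).toNat < (y.eval mem r).toNat then p.eval mem r else q.eval mem r

/-- All registers mentioned in an expression are below `bound`. -/
def bound : Expr → ℕ
  | reg s => s + 1
  | const _ => 0
  | wordSize => 0
  | op _ x y => max x.bound y.bound
  | load x => x.bound
  | iteEq x y p q => max (max x.bound y.bound) (max p.bound q.bound)
  | iteLt x y p q => max (max x.bound y.bound) (max p.bound q.bound)

/-- A bound for the running time of the compiled expression. -/
def cost : Expr → ℕ
  | reg _ => 1
  | const _ => 1
  | wordSize => 1
  | op _ x y => x.cost + y.cost + 1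
  | load x => x.cost + 1
  | iteEq x y p q => x.cost + y.cost + p.cost + q.cost + 1
  | iteLt x y p q => x.cost + y.cost + p.cost + q.cost + 1

/-- Compilation of an expression: the value goes to register `d`, and the registers below `d`
are left alone. -/
def compile : Expr → ℕ → Prog
  | reg s, d => .instr (.move d s)
  | const a, d => .instr (.const d a)
  | wordSize, d => .instr (.wordSize d)
  | op o x y, d => .seq (x.compile d) (.seq (y.compile (d + 1)) (.instr (.op o d d (d + 1))))
  | load x, d => .seq (x.compile d) (.instr (.load d d))
  | iteEq x y p q, d => .seq (x.compile d) (.seq (y.compile (d + 1))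
      (.cond (.eq d (d + 1)) (p.compile d) (q.compile d)))
  | iteLt x y p q, d => .seq (x.compile d) (.seq (y.compile (d + 1))
      (.cond (.lt d (d + 1)) (p.compile d) (q.compile d)))

theorem eval_congr {w : ℕ} (mem : BitVec w → BitVec w) {r r' : Regs w} (e : Expr)
    (h : ∀ j < e.bound, r j = r' j) : e.eval mem r = e.eval mem r' := by
  induction e with
  | reg s => exact h s (Nat.lt_succ_self s)
  | const a => rfl
  | wordSize => rfl
  | op o x y hx hy =>
    simp only [bound, lt_max_iff] at h
    simp only [eval]
    rw [hx fun j hj => h j (.inl hj), hy fun j hj => h j (.inr hj)]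
  | load x hx =>
    simp only [eval]
    rw [hx h]
  | iteEq x y p q hx hy hp hq =>
    simp only [bound, lt_max_iff] at h
    simp only [eval]
    rw [hx fun j hj => h j (.inl (.inl hj)), hy fun j hj => h j (.inl (.inr hj)),
      hp fun j hj => h j (.inr (.inl hj)), hq fun j hj => h j (.inr (.inr hj))]
  | iteLt x y p q hx hy hp hq =>
    simp only [bound, lt_max_iff] at h
    simp only [eval]
    rw [hx fun j hj => h j (.inl (.inl hj)), hy fun j hj => h j (.inl (.inr hj)),
      hp fun j hj => h j (.inr (.inl hj)), hq fun j hj => h j (.inr (.inr hj))]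

/-- Running two compiled expressions one after the other. -/
theorem exec_pair {w : ℕ} {mem : BitVec w → BitVec w} {x y : Expr} {d : ℕ} {r : Regs w}
    (hx : ∃ r' t, t ≤ x.cost ∧ Exec mem (x.compile d) r r' t ∧ r' d = x.eval mem r ∧
      ∀ j < d, r' j = r j)
    (hy : ∀ r : Regs w, ∃ r' t, t ≤ y.cost ∧ Exec mem (y.compile (d + 1)) r r' t ∧
      r' (d + 1) = y.eval mem r ∧ ∀ j < d + 1, r' j = r j)
    (hb : y.bound ≤ d) :
    ∃ r₁ r₂ t₁ t₂, t₁ ≤ x.cost ∧ t₂ ≤ y.cost ∧ Exec mem (x.compile d) r r₁ t₁ ∧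
      Exec mem (y.compile (d + 1)) r₁ r₂ t₂ ∧ r₂ d = x.eval mem r ∧
      r₂ (d + 1) = y.eval mem r ∧ ∀ j < d, r₂ j = r j := by
  obtain ⟨r₁, t₁, h₁, e₁, v₁, p₁⟩ := hx
  obtain ⟨r₂, t₂, h₂, e₂, v₂, p₂⟩ := hy r₁
  refine ⟨r₁, r₂, t₁, t₂, h₁, h₂, e₁, e₂, ?_, ?_, fun j hj => ?_⟩
  · rw [p₂ d (Nat.lt_succ_self d), v₁]
  · rw [v₂]
    exact eval_congr mem y fun j hj => p₁ j (lt_of_lt_of_le hj hb)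
  · rw [p₂ j (by omega), p₁ j hj]

/-- The registers from `d` upwards act as an evaluation stack: the first operand rests in `d` while
the second is computed from `d + 1` on. All inputs lie below `d` and survive, so by `eval_congr`
later parts can be evaluated as if on the initial registers. -/
theorem compile_spec {w : ℕ} (mem : BitVec w → BitVec w) (e : Expr) :
    ∀ (d : ℕ) (r : Regs w), e.bound ≤ d →
      ∃ r' t, t ≤ e.cost ∧ Exec mem (e.compile d) r r' t ∧ r' d = e.eval mem r ∧
        ∀ j < d, r' j = r j := by
  induction e with
  | reg s =>
    exact fun d r _ => ⟨_, 1, le_rfl, .instr _ _, by simp [Instr.eval, eval],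
      fun j hj => by simp [Instr.eval, hj.ne]⟩
  | const a =>
    exact fun d r _ => ⟨_, 1, le_rfl, .instr _ _, by simp [Instr.eval, eval],
      fun j hj => by simp [Instr.eval, hj.ne]⟩
  | wordSize =>
    exact fun d r _ => ⟨_, 1, le_rfl, .instr _ _, by simp [Instr.eval, eval],
      fun j hj => by simp [Instr.eval, hj.ne]⟩
  | op o x y hx hy =>
    intro d r hb
    simp only [bound, max_le_iff] at hb
    obtain ⟨r₁, r₂, t₁, t₂, h₁, h₂, e₁, e₂, v₁, v₂, p⟩ :=
      exec_pair (hx d r hb.1) (fun r => hy (d + 1) r (by omega)) hb.2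
    refine ⟨_, _, ?_, .seq e₁ (.seq e₂ (.instr _ _)), ?_, fun j hj => ?_⟩
    · simp only [cost]; omega
    · simp [Instr.eval, eval, v₁, v₂]
    · simp [Instr.eval, hj.ne, p j hj]
  | load x hx =>
    intro d r hb
    obtain ⟨r₁, t₁, h₁, e₁, v₁, p₁⟩ := hx d r hb
    refine ⟨_, _, ?_, .seq e₁ (.instr _ _), ?_, fun j hj => ?_⟩
    · simp only [cost]; omega
    · simp [Instr.eval, eval, v₁]
    · simp [Instr.eval, hj.ne, p₁ j hj]
  | iteEq x y p q hx hy hp hq =>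
    intro d r hb
    simp only [bound, max_le_iff] at hb
    obtain ⟨r₁, r₂, t₁, t₂, h₁, h₂, e₁, e₂, v₁, v₂, pr⟩ :=
      exec_pair (hx d r hb.1.1) (fun r => hy (d + 1) r (by omega)) hb.1.2
    by_cases hc : x.eval mem r = y.eval mem r
    · obtain ⟨r₃, t₃, h₃, e₃, v₃, p₃⟩ := hp d r₂ hb.2.1
      refine ⟨r₃, _, ?_, .seq e₁ (.seq e₂ (.condTrue ?_ e₃)), ?_, fun j hj => ?_⟩
      · simp only [cost]; omega
      · simpa [Test.Holds, v₁, v₂] using hc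
      · simp only [eval, if_pos hc]
        rw [v₃]
        exact eval_congr mem p fun j hj => pr j (lt_of_lt_of_le hj hb.2.1)
      · rw [p₃ j hj, pr j hj]
    · obtain ⟨r₃, t₃, h₃, e₃, v₃, p₃⟩ := hq d r₂ hb.2.2
      refine ⟨r₃, _, ?_, .seq e₁ (.seq e₂ (.condFalse ?_ e₃)), ?_, fun j hj => ?_⟩
      · simp only [cost]; omega
      · simpa [Test.Holds, v₁, v₂] using hc
      · simp only [eval, if_neg hc]
        rw [v₃]
        exact eval_congr mem q fun j hj => pr j (lt_of_lt_of_le hj hb.2.2)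
      · rw [p₃ j hj, pr j hj]
  | iteLt x y p q hx hy hp hq =>
    intro d r hb
    simp only [bound, max_le_iff] at hb
    obtain ⟨r₁, r₂, t₁, t₂, h₁, h₂, e₁, e₂, v₁, v₂, pr⟩ :=
      exec_pair (hx d r hb.1.1) (fun r => hy (d + 1) r (by omega)) hb.1.2
    by_cases hc : (x.eval mem r).toNat < (y.eval mem r).toNat
    · obtain ⟨r₃, t₃, h₃, e₃, v₃, p₃⟩ := hp d r₂ hb.2.1
      refine ⟨r₃, _, ?_, .seq e₁ (.seq e₂ (.condTrue ?_ e₃)), ?_, fun j hj => ?_⟩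
      · simp only [cost]; omega
      · simpa [Test.Holds, v₁, v₂] using hc
      · simp only [eval, if_pos hc]
        rw [v₃]
        exact eval_congr mem p fun j hj => pr j (lt_of_lt_of_le hj hb.2.1)
      · rw [p₃ j hj, pr j hj]
    · obtain ⟨r₃, t₃, h₃, e₃, v₃, p₃⟩ := hq d r₂ hb.2.2
      refine ⟨r₃, _, ?_, .seq e₁ (.seq e₂ (.condFalse ?_ e₃)), ?_, fun j hj => ?_⟩
      · simp only [cost]; omega
      · simpa [Test.Holds, v₁, v₂] using hc
      · simp only [eval, if_neg hc]
        rw [v₃]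
        exact eval_congr mem q fun j hj => pr j (lt_of_lt_of_le hj hb.2.2)
      · rw [p₃ j hj, pr j hj]

/-- Compute `E 0, …, E (N - 1)` into the registers `d, …, d + N - 1`. -/
def compileFamily (E : ℕ → Expr) (d : ℕ) : ℕ → Prog
  | 0 => .instr (.move 0 0)
  | N + 1 => .seq (compileFamily E d N) ((E N).compile (d + N))

/-- Copy the registers `d, …, d + N - 1` to `0, …, N - 1`. -/
def moveFamily (d : ℕ) : ℕ → Prog
  | 0 => .instr (.move 0 0)
  | N + 1 => .seq (moveFamily d N) (.instr (.move N (d + N)))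

theorem compileFamily_spec {w : ℕ} (mem : BitVec w → BitVec w) (E : ℕ → Expr) (d : ℕ)
    (r : Regs w) : ∀ N, (∀ j < N, (E j).bound ≤ d) →
      ∃ r' t, t ≤ 1 + ∑ j ∈ Finset.range N, (E j).cost ∧ Exec mem (compileFamily E d N) r r' t ∧
        (∀ j < N, r' (d + j) = (E j).eval mem r) ∧ ∀ j < d, r' j = r j
  | 0, _ => ⟨_, 1, by simp, .instr _ _, by simp, fun j _ => by simp [Instr.eval]⟩
  | N + 1, hb => by
    obtain ⟨r₁, t₁, h₁, e₁, v₁, p₁⟩ := compileFamily_spec mem E d r N fun j hj => hb j (by omega)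
    obtain ⟨r₂, t₂, h₂, e₂, v₂, p₂⟩ := compile_spec mem (E N) (d + N) r₁
      ((hb N (by omega)).trans (by omega))
    refine ⟨r₂, _, ?_, .seq e₁ e₂, fun j hj => ?_, fun j hj => ?_⟩
    · rw [Finset.sum_range_succ]; omega
    · rcases Nat.lt_succ_iff_lt_or_eq.1 hj with hj | rfl
      · rw [p₂ _ (by omega), v₁ j hj]
      · rw [v₂]
        exact eval_congr mem _ fun i hi => p₁ i (lt_of_lt_of_le hi (hb j (by omega)))
    · rw [p₂ j (by omega), p₁ j hj]

theorem moveFamily_spec {w : ℕ} (mem : BitVec w → BitVec w) (d : ℕ) (r : Regs w) :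
    ∀ N, N ≤ d → ∃ r', Exec mem (moveFamily d N) r r' (N + 1) ∧
      (∀ j < N, r' j = r (d + j)) ∧ ∀ j, N ≤ j → r' j = r j
  | 0, _ => ⟨_, .instr _ _, by simp, fun j _ => by simp [Instr.eval]⟩
  | N + 1, hN => by
    obtain ⟨r₁, e₁, v₁, p₁⟩ := moveFamily_spec mem d r N (by omega)
    refine ⟨_, .seq e₁ (.instr _ _), fun j hj => ?_, fun j hj => ?_⟩
    · rcases Nat.lt_succ_iff_lt_or_eq.1 hj with hj | rfl
      · simp [Instr.eval, hj.ne, v₁ j hj]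
      · simp [Instr.eval, p₁ (d + j) (by omega)]
    · simp [Instr.eval, show j ≠ N by omega, p₁ j (by omega)]

/-- Finitely many expressions are computed simultaneously by a program in constant time. -/
theorem exists_prog (N : ℕ) (E : ℕ → Expr) :
    ∃ (prog : Prog) (T : ℕ), ∀ (w : ℕ) (mem : BitVec w → BitVec w) (r : Regs w),
      ∃ r' t, t ≤ T ∧ Exec mem prog r r' t ∧ ∀ j < N, r' j = (E j).eval mem r := by
  -- The work space lies above all input registers, so no input is overwritten before the last
  -- expression is computed, and above the `N` targets, so the final copying destroys no result.
  set d := N + ∑ j ∈ Finset.range N, (E j).bound with hd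
  refine ⟨.seq (compileFamily E d N) (moveFamily d N),
    1 + ∑ j ∈ Finset.range N, (E j).cost + (N + 1), fun w mem r => ?_⟩
  obtain ⟨r₁, t₁, h₁, e₁, v₁, -⟩ := compileFamily_spec mem E d r N fun j hj =>
    (Finset.single_le_sum (f := fun j => (E j).bound) (fun _ _ => Nat.zero_le _)
      (Finset.mem_range.2 hj)).trans (by omega)
  obtain ⟨r₂, e₂, v₂, -⟩ := moveFamily_spec mem d r₁ N (by omega)
  exact ⟨r₂, _, by omega, .seq e₁ e₂, fun j hj => by rw [v₂ j hj, v₁ j hj]⟩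

theorem eval_iteEq_of_eq {w : ℕ} {mem : BitVec w → BitVec w} {r : Regs w} {x y : Expr}
    (p q : Expr) (h : x.eval mem r = y.eval mem r) :
    (iteEq x y p q).eval mem r = p.eval mem r := if_pos h

theorem eval_iteEq_of_ne {w : ℕ} {mem : BitVec w → BitVec w} {r : Regs w} {x y : Expr}
    (p q : Expr) (h : x.eval mem r ≠ y.eval mem r) :
    (iteEq x y p q).eval mem r = q.eval mem r := if_neg h

/-! ### Finite functions as expressions -/

/-- A chain of comparisons selects the branch that belongs to the value of `x`. -/
theorem exists_switch {w : ℕ} (x : Expr) (E : ℕ → Expr) : ∀ N, N ≤ 2 ^ w → ∃ e : Expr,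
    ∀ (mem : BitVec w → BitVec w) (r : Regs w), (x.eval mem r).toNat < N →
      e.eval mem r = (E (x.eval mem r).toNat).eval mem r
  | 0, _ => ⟨.const 0, fun _ _ h => absurd h (Nat.not_lt_zero _)⟩
  | N + 1, hN => by
    obtain ⟨e, he⟩ := exists_switch (w := w) x E N (by omega)
    refine ⟨.iteEq x (.const N) (E N) e, fun mem r h => ?_⟩
    have hv : (BitVec.ofNat w N).toNat = N := by
      rw [BitVec.toNat_ofNat, Nat.mod_eq_of_lt (by omega)]
    by_cases hx : x.eval mem r = BitVec.ofNat w N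
    · rw [eval_iteEq_of_eq _ _ hx, hx, hv]
    · rw [eval_iteEq_of_ne _ _ hx]
      refine he mem r (lt_of_le_of_ne (Nat.lt_succ_iff.1 h) fun h' => hx ?_)
      exact BitVec.eq_of_toNat_eq (by rw [h', hv])

/-- Every function of finitely many expressions is given by an expression. -/
theorem exists_eval_eq_map {w : ℕ} : ∀ (l : List Expr) (F : List (BitVec w) → BitVec w),
    ∃ e : Expr, ∀ (mem : BitVec w → BitVec w) (r : Regs w),
      e.eval mem r = F (l.map fun x => x.eval mem r)
  | [], F => ⟨.const (F []).toNat, fun _ _ => by simp [eval]⟩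
  | x :: l, F => by
    -- Induction on the number of arguments: each of the `2 ^ w` values of `x` gets its own
    -- expression in the remaining arguments.
    choose E hE using fun v : ℕ => exists_eval_eq_map l fun t => F (BitVec.ofNat w v :: t)
    obtain ⟨e, he⟩ := exists_switch (w := w) x E (2 ^ w) le_rfl
    exact ⟨e, fun mem r => by rw [he mem r (BitVec.isLt _), hE]; simp⟩

/-- At a fixed word size every function of the memory and of the first `k` registers is given by
an expression. -/
theorem exists_eval_eq (w k : ℕ)
    (F : (BitVec w → BitVec w) → (ℕ → BitVec w) → BitVec w) :
    ∃ e : Expr, ∀ (mem : BitVec w → BitVec w) (r : Regs w), (∀ j, k ≤ j → r j = 0) →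
      e.eval mem r = F mem r := by
  obtain ⟨e, he⟩ := exists_eval_eq_map (w := w)
    -- At a fixed word size the memory is finite, so all of its words can be listed as arguments.
    ((List.range k).map Expr.reg ++ (List.range (2 ^ w)).map fun a => Expr.load (.const a))
    fun l => F (fun a => l.getD (k + a.toNat) 0) fun j => if j < k then l.getD j 0 else 0
  refine ⟨e, fun mem r hr => ?_⟩
  rw [he]
  congr 1
  · funext a
    have ha := a.isLt
    simp [List.getD_eq_getElem?_getD, ha, eval]
  · funext j
    split_ifs with hj
    · simp [List.getD_eq_getElem?_getD, List.getElem?_append_left, hj, eval]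
    · exact (hr j (by omega)).symm

/-- Branching on the word size, with `E w` for `w < N` and `e` for all larger word sizes. -/
theorem exists_dispatch (N : ℕ) (E : ℕ → Expr) (e : Expr) : ∃ e' : Expr,
    ∀ (w : ℕ) (mem : BitVec w → BitVec w) (r : Regs w),
      e'.eval mem r = if w < N then (E w).eval mem r else e.eval mem r := by
  -- The word sizes are tested in increasing order. Thus a numeral is compared with `w` only if it
  -- is at most `w`, and reduction modulo `2 ^ w` does not change it.
  suffices h : ∀ k, ∃ e' : Expr, ∀ (w : ℕ) (mem : BitVec w → BitVec w) (r : Regs w),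
      N ≤ w + k → e'.eval mem r = if w < N then (E w).eval mem r else e.eval mem r by
    obtain ⟨e', he⟩ := h N
    exact ⟨e', fun w mem r => he w mem r (by omega)⟩
  intro k
  induction k with
  | zero => exact ⟨e, fun w mem r h => by rw [if_neg (by omega)]⟩
  | succ k ih =>
    obtain ⟨e', he⟩ := ih
    by_cases hk : N ≤ k
    · exact ⟨e', fun w mem r h => he w mem r (by omega)⟩
    refine ⟨.iteEq .wordSize (.const (N - (k + 1))) (E (N - (k + 1))) e', fun w mem r h => ?_⟩
    have hw : w < 2 ^ w := Nat.lt_two_pow_self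
    have key : wordSize.eval mem r = (const (N - (k + 1))).eval mem r ↔ w = N - (k + 1) := by
      refine ⟨fun h' => ?_, fun h' => by rw [← h']; rfl⟩
      have := congrArg BitVec.toNat h'
      simp only [eval] at this
      rwa [BitVec.toNat_ofNat, BitVec.toNat_ofNat, Nat.mod_eq_of_lt hw,
        Nat.mod_eq_of_lt (by omega)] at this
    by_cases h₁ : w = N - (k + 1)
    · rw [eval_iteEq_of_eq _ _ (key.2 h₁), if_pos (by omega), ← h₁]
    · rw [eval_iteEq_of_ne _ _ (mt key.1 h₁), he w mem r (by omega)]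

/-! ### Values of expressions as natural numbers -/

section Values

variable {w : ℕ} {mem : BitVec w → BitVec w} {r : Regs w}

/-- The expression `e` has the value `a`. -/
def Val (mem : BitVec w → BitVec w) (r : Regs w) (e : Expr) (a : ℕ) : Prop :=
  (e.eval mem r).toNat = a

theorem Val.lt {e : Expr} {a : ℕ} (h : Val mem r e a) : a < 2 ^ w := h ▸ BitVec.isLt _

theorem Val.congr {e : Expr} {a b : ℕ} (h : Val mem r e a) (hab : a = b) : Val mem r e b :=
  hab ▸ h

theorem val_const {a : ℕ} (h : a < 2 ^ w) : Val mem r (.const a) a := by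
  simp [Val, eval, Nat.mod_eq_of_lt h]

theorem val_wordSize : Val mem r .wordSize w := by
  simp [Val, eval, Nat.mod_eq_of_lt Nat.lt_two_pow_self]

variable {x y p q : Expr} {a b : ℕ}

theorem Val.add (hx : Val mem r x a) (hy : Val mem r y b) (h : a + b < 2 ^ w) :
    Val mem r (.op .add x y) (a + b) := by
  simp only [Val, eval, BinOp.eval, BitVec.toNat_add] at *
  rw [hx, hy, Nat.mod_eq_of_lt h]

theorem Val.sub (hx : Val mem r x a) (hy : Val mem r y b) (h : b ≤ a) :
    Val mem r (.op .sub x y) (a - b) := by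
  have ha := hx.lt
  simp only [Val, eval, BinOp.eval, BitVec.toNat_sub] at *
  rw [hx, hy, show 2 ^ w - b + a = (a - b) + 2 ^ w by omega, Nat.add_mod_right,
    Nat.mod_eq_of_lt (by omega)]

theorem Val.mulMod (hx : Val mem r x a) (hy : Val mem r y b) :
    Val mem r (.op .mul x y) (a * b % 2 ^ w) := by
  simp only [Val, eval, BinOp.eval, BitVec.toNat_mul] at *
  rw [hx, hy]

theorem Val.mul (hx : Val mem r x a) (hy : Val mem r y b) (h : a * b < 2 ^ w) :
    Val mem r (.op .mul x y) (a * b) :=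
  (hx.mulMod hy).congr (Nat.mod_eq_of_lt h)

theorem Val.div (hx : Val mem r x a) (hy : Val mem r y b) :
    Val mem r (.op .div x y) (a / b) := by
  simp only [Val, eval, BinOp.eval, BitVec.toNat_udiv] at *
  rw [hx, hy]

theorem Val.mod (hx : Val mem r x a) (hy : Val mem r y b) :
    Val mem r (.op .mod x y) (a % b) := by
  simp only [Val, eval, BinOp.eval, BitVec.toNat_umod] at *
  rw [hx, hy]

theorem Val.or (hx : Val mem r x a) (hy : Val mem r y b) :
    Val mem r (.op .or x y) (a ||| b) := by
  simp only [Val, eval, BinOp.eval, BitVec.toNat_or] at *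
  rw [hx, hy]

theorem Val.shl (hx : Val mem r x a) (hy : Val mem r y b) :
    Val mem r (.op .shl x y) (a * 2 ^ b % 2 ^ w) := by
  simp only [Val, eval, BinOp.eval, BitVec.shiftLeft_eq', BitVec.toNat_shiftLeft] at *
  rw [hx, hy, Nat.shiftLeft_eq]

theorem Val.shr (hx : Val mem r x a) (hy : Val mem r y b) :
    Val mem r (.op .shr x y) (a / 2 ^ b) := by
  simp only [Val, eval, BinOp.eval, BitVec.ushiftRight_eq', BitVec.toNat_ushiftRight] at *
  rw [hx, hy, Nat.shiftRight_eq_div_pow]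

theorem Val.load (hx : Val mem r x a) :
    Val mem r (.load x) (mem (BitVec.ofNat w a)).toNat := by
  simp only [Val, eval] at *
  rw [← hx, BitVec.ofNat_toNat, BitVec.setWidth_eq]

theorem Val.iteEq_eq (hx : Val mem r x a) (hy : Val mem r y b) (h : a = b) :
    (Expr.iteEq x y p q).eval mem r = p.eval mem r :=
  eval_iteEq_of_eq _ _ (BitVec.eq_of_toNat_eq (by rw [hx, hy, h]))

theorem Val.iteEq_ne (hx : Val mem r x a) (hy : Val mem r y b) (h : a ≠ b) :
    (Expr.iteEq x y p q).eval mem r = q.eval mem r :=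
  eval_iteEq_of_ne _ _ fun h' => h (by rw [← hx, ← hy, h'])

theorem Val.iteLt_lt (hx : Val mem r x a) (hy : Val mem r y b) (h : a < b) :
    (Expr.iteLt x y p q).eval mem r = p.eval mem r :=
  if_pos (by rw [hx, hy]; exact h)

theorem Val.iteLt_le (hx : Val mem r x a) (hy : Val mem r y b) (h : b ≤ a) :
    (Expr.iteLt x y p q).eval mem r = q.eval mem r :=
  if_neg (by rw [hx, hy]; exact not_lt.2 h)

end Values

end Expr

/-! ### Multiply-shift hashing -/

/-- The multiply-shift hash function on numbers below `2 ^ b`. -/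
def msHash (b s a x : ℕ) : ℕ := a * x % 2 ^ b / 2 ^ s

theorem msHash_lt {b s a x : ℕ} (hs : s ≤ b) : msHash b s a x < 2 ^ (b - s) := by
  rw [msHash, Nat.div_lt_iff_lt_mul (by positivity), ← pow_add, Nat.sub_add_cancel hs]
  exact Nat.mod_lt _ (by positivity)

/-- The multipliers: the odd numbers below `2 ^ b`. -/
def multipliers (b : ℕ) : Finset ℕ := {a ∈ Finset.range (2 ^ b) | a % 2 = 1}

theorem card_multipliers {b : ℕ} (hb : 1 ≤ b) : (multipliers b).card = 2 ^ (b - 1) := by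
  have : multipliers b = (Finset.range (2 ^ (b - 1))).image fun k => 2 * k + 1 := by
    obtain ⟨b, rfl⟩ := Nat.exists_eq_add_of_le' hb
    ext a
    simp only [multipliers, Finset.mem_filter, Finset.mem_range, Finset.mem_image,
      Nat.add_sub_cancel, pow_succ]
    constructor
    · rintro ⟨h, h'⟩
      exact ⟨a / 2, by omega, by omega⟩
    · rintro ⟨k, h, rfl⟩
      exact ⟨by omega, by omega⟩
  rw [this, Finset.card_image_of_injective _ fun x y h => by simpa using h, Finset.card_range]

/-- Two different keys collide under few multipliers. -/
theorem card_collide_le_of_lt {b s x y : ℕ} (hy : y < x) (hx : x < 2 ^ b) :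
    {a ∈ multipliers b | msHash b s a x = msHash b s a y}.card ≤ 2 ^ s := by
  -- Write `x - y = 2^v * z` with `z` odd. The difference `R a` of the two residues is congruent to
  -- `2^v * a * z` modulo `2^b`; as `a` is odd and `v < b`, it is an odd multiple of `2^v`. A
  -- collision forces `|R a| < 2^s`.
  obtain ⟨v, z, hz, hvz⟩ := Nat.exists_eq_two_pow_mul_odd (n := x - y) (by omega)
  have hvb : v < b := by
    by_contra! h
    have h1 : 2 ^ b ≤ 2 ^ v := Nat.pow_le_pow_right (by norm_num) h
    have h2 : 2 ^ v ≤ x - y := hvz ▸ Nat.le_mul_of_pos_right _ hz.pos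
    omega
  obtain ⟨g, rfl⟩ : ∃ g, b = v + (g + 1) := ⟨b - v - 1, by omega⟩
  set R : ℕ → ℤ := fun a =>
    ((a * x % 2 ^ (v + (g + 1)) : ℕ) : ℤ) - ((a * y % 2 ^ (v + (g + 1)) : ℕ) : ℤ) with hR
  have hRmod : ∀ a, ∃ q : ℤ, R a = 2 ^ v * (a * z - 2 ^ (g + 1) * q) := fun a => by
    refine ⟨((a * x / 2 ^ (v + (g + 1)) : ℕ) : ℤ) - ((a * y / 2 ^ (v + (g + 1)) : ℕ) : ℤ), ?_⟩
    have h1 : ((a * x % 2 ^ (v + (g + 1)) : ℕ) : ℤ) +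
        2 ^ (v + (g + 1)) * ((a * x / 2 ^ (v + (g + 1)) : ℕ) : ℤ) = a * x := by
      exact_mod_cast Nat.mod_add_div (a * x) (2 ^ (v + (g + 1)))
    have h2 : ((a * y % 2 ^ (v + (g + 1)) : ℕ) : ℤ) +
        2 ^ (v + (g + 1)) * ((a * y / 2 ^ (v + (g + 1)) : ℕ) : ℤ) = a * y := by
      exact_mod_cast Nat.mod_add_div (a * y) (2 ^ (v + (g + 1)))
    have h3 : (2 : ℤ) ^ v * z = x - y := by
      have : ((x - y : ℕ) : ℤ) = (x : ℤ) - y := Nat.cast_sub hy.le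
      rw [← this, hvz]; push_cast; ring
    simp only [hR]
    linear_combination h1 - h2 - (a : ℤ) * h3
  have hcoll : ∀ a, msHash (v + (g + 1)) s a x = msHash (v + (g + 1)) s a y →
      |R a| < 2 ^ s := fun a h => by
    rw [msHash, msHash] at h
    have hp : 0 < 2 ^ s := by positivity
    have h1 := Nat.mod_add_div (a * x % 2 ^ (v + (g + 1))) (2 ^ s)
    have h2 := Nat.mod_add_div (a * y % 2 ^ (v + (g + 1))) (2 ^ s)
    have h3 := Nat.mod_lt (a * x % 2 ^ (v + (g + 1))) hp
    have h4 := Nat.mod_lt (a * y % 2 ^ (v + (g + 1))) hp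
    rw [h] at h1
    have h5 : ((2 ^ s : ℕ) : ℤ) = 2 ^ s := by push_cast; rfl
    rw [abs_lt, ← h5]
    simp only [hR]
    generalize a * x % 2 ^ (v + (g + 1)) = X at *
    generalize a * y % 2 ^ (v + (g + 1)) = Y at *
    generalize 2 ^ s * (Y / 2 ^ s) = Q at *
    constructor <;> omega
  have hodd : ∀ a ∈ multipliers (v + (g + 1)), ∃ k : ℤ, R a = 2 ^ v * (2 * k + 1) := fun a ha => by
    obtain ⟨q, hq⟩ := hRmod a
    have hao : Odd a := Nat.odd_iff.2 (Finset.mem_filter.1 ha).2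
    obtain ⟨l, hl⟩ := hao.mul hz
    refine ⟨l - 2 ^ g * q, ?_⟩
    have hl' : (a : ℤ) * z = 2 * l + 1 := by exact_mod_cast hl
    rw [hq, hl', pow_succ]; ring
  have hdiv : ∀ k : ℤ, 2 ^ v * (2 * k + 1) / 2 ^ (v + 1) = k := fun k => by
    rw [pow_succ, Int.mul_ediv_mul_of_pos _ _ (by positivity)]; omega
  by_cases hvs : s ≤ v
  · refine (Finset.card_eq_zero.2 (Finset.filter_eq_empty_iff.2 fun a ha h => ?_)).le.trans
      (Nat.zero_le _)
    obtain ⟨k, hk⟩ := hodd a ha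
    have h1 := hcoll a h
    rw [hk, abs_mul, abs_of_pos (by positivity : (0 : ℤ) < 2 ^ v)] at h1
    have h2 : (1 : ℤ) ≤ |2 * k + 1| := Int.one_le_abs (by omega)
    have h3 : (2 : ℤ) ^ s ≤ 2 ^ v := pow_le_pow_right₀ (by norm_num) hvs
    nlinarith [show (0 : ℤ) < 2 ^ v by positivity]
  obtain ⟨u, rfl⟩ : ∃ u, s = v + (u + 1) := ⟨s - v - 1, by omega⟩
  have hcard : (Finset.Ico (-2 ^ u : ℤ) (2 ^ u) ×ˢ Finset.range (2 ^ v)).card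
      = 2 ^ (v + (u + 1)) := by
    rw [Finset.card_product, Int.card_Ico, Finset.card_range]
    have : ((2 : ℤ) ^ u - -2 ^ u).toNat = 2 ^ (u + 1) := by
      rw [show (2 : ℤ) ^ u - -2 ^ u = ((2 ^ (u + 1) : ℕ) : ℤ) by push_cast; ring, Int.toNat_natCast]
    rw [this, ← pow_add, add_comm]
  rw [← hcard]
  -- With `s = v+u+1` the odd factor `2*k+1` of `R a` leaves `2^(u+1)` choices of `k`. It determines
  -- `a * z`, hence `a`, modulo `2^(g+1)`, because `z` is odd; the quotient of `a` has `2^v`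
  -- choices.
  refine Finset.card_le_card_of_injOn (fun a => (R a / 2 ^ (v + 1), a / 2 ^ (g + 1)))
    (fun a ha => ?_) (fun a ha a' ha' h => ?_)
  · obtain ⟨ha, hc⟩ := Finset.mem_filter.1 ha
    obtain ⟨k, hk⟩ := hodd a ha
    have h1 := hcoll a hc
    rw [hk, pow_add, abs_mul, abs_of_pos (by positivity : (0 : ℤ) < 2 ^ v)] at h1
    have h2 := abs_lt.1 (lt_of_mul_lt_mul_left h1 (by positivity))
    rw [pow_succ] at h2
    simp only [Finset.coe_product, Set.mem_prod, Finset.mem_coe, Finset.mem_Ico, Finset.mem_range]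
    rw [hk, hdiv]
    refine ⟨⟨by omega, by omega⟩, ?_⟩
    rw [Nat.div_lt_iff_lt_mul (by positivity), ← pow_add]
    exact Finset.mem_range.1 (Finset.mem_filter.1 ha).1
  · obtain ⟨ha, -⟩ := Finset.mem_filter.1 ha
    obtain ⟨ha', -⟩ := Finset.mem_filter.1 ha'
    obtain ⟨k, hk⟩ := hodd a ha
    obtain ⟨k', hk'⟩ := hodd a' ha'
    simp only [Prod.mk.injEq] at h
    rw [hk, hk', hdiv, hdiv] at h
    obtain ⟨q, hq⟩ := hRmod a
    obtain ⟨q', hq'⟩ := hRmod a'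
    have h1 : (a : ℤ) * z - 2 ^ (g + 1) * q = a' * z - 2 ^ (g + 1) * q' := by
      have : (2 : ℤ) ^ v * (a * z - 2 ^ (g + 1) * q) = 2 ^ v * (a' * z - 2 ^ (g + 1) * q') := by
        rw [← hq, ← hq', hk, hk', h.1]
      exact mul_left_cancel₀ (by positivity) this
    have h2 : ((2 ^ (g + 1) : ℕ) : ℤ) ∣ (a' - a) * z := ⟨q' - q, by push_cast; linarith⟩
    have h3 : IsCoprime ((2 ^ (g + 1) : ℕ) : ℤ) (z : ℤ) :=
      Nat.isCoprime_iff_coprime.2 (Nat.Coprime.pow_left _ (Nat.coprime_two_left.2 hz))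
    have h4 : a % 2 ^ (g + 1) = a' % 2 ^ (g + 1) :=
      (Nat.modEq_iff_dvd.2 (h3.dvd_of_dvd_mul_right h2))
    rw [← Nat.mod_add_div a (2 ^ (g + 1)), ← Nat.mod_add_div a' (2 ^ (g + 1)), h4, h.2]

theorem card_collide_le {b s x y : ℕ} (hxy : x ≠ y) (hx : x < 2 ^ b) (hy : y < 2 ^ b) :
    {a ∈ multipliers b | msHash b s a x = msHash b s a y}.card ≤ 2 ^ s := by
  rcases hxy.lt_or_gt with h | h
  · simpa only [eq_comm] using card_collide_le_of_lt (s := s) h hy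
  · exact card_collide_le_of_lt h hx

/-! ### Averaging over the multipliers, and two-level perfect hashing -/

/-- The pairs of different keys that collide. -/
def collisions (b s a : ℕ) (S : Finset ℕ) : Finset (ℕ × ℕ) :=
  {q ∈ S.offDiag | msHash b s a q.1 = msHash b s a q.2}

/-- Some multiplier causes no more collisions than the average one. -/
theorem exists_few_collisions {b : ℕ} (s : ℕ) (hb : 1 ≤ b) (S : Finset ℕ)
    (hS : ∀ x ∈ S, x < 2 ^ b) :
    ∃ a < 2 ^ b, (collisions b s a S).card * 2 ^ (b - 1) ≤ (S.card * S.card - S.card) * 2 ^ s := by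
  have hne : (multipliers b).Nonempty := by
    rw [← Finset.card_pos, card_multipliers hb]; positivity
  have hsum : ∑ a ∈ multipliers b, (collisions b s a S).card
      ≤ (S.card * S.card - S.card) * 2 ^ s := by
    simp only [collisions, Finset.card_filter]
    rw [Finset.sum_comm, ← Finset.offDiag_card]
    refine Finset.sum_le_card_nsmul _ _ _ fun q hq => ?_
    obtain ⟨h1, h2, h3⟩ := Finset.mem_offDiag.1 hq
    rw [← Finset.card_filter]
    exact card_collide_le h3 (hS _ h1) (hS _ h2)
  by_contra! hcon
  have : ∑ a ∈ multipliers b, (S.card * S.card - S.card) * 2 ^ s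
      < ∑ a ∈ multipliers b, (collisions b s a S).card * 2 ^ (b - 1) :=
    Finset.sum_lt_sum_of_nonempty hne fun a ha =>
      hcon a (Finset.mem_range.1 (Finset.mem_filter.1 ha).1)
  rw [Finset.sum_const, card_multipliers hb, ← Finset.sum_mul, smul_eq_mul, mul_comm] at this
  exact absurd hsum (not_le.2 (lt_of_mul_lt_mul_right this (Nat.zero_le _)))

/-- A set of keys is hashed injectively into a table of quadratic size. -/
theorem exists_injOn_msHash {b l : ℕ} (hl : l ≤ b) (hb : 1 ≤ b) (S : Finset ℕ)
    (hS : ∀ x ∈ S, x < 2 ^ b) (hc : 2 * S.card ^ 2 ≤ 2 ^ l) :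
    ∃ a < 2 ^ b, Set.InjOn (msHash b (b - l) a) S := by
  rcases S.eq_empty_or_nonempty with rfl | hne
  · exact ⟨0, by positivity, by simp⟩
  obtain ⟨a, ha, h⟩ := exists_few_collisions (b - l) hb S hS
  refine ⟨a, ha, fun x hx y hy hxy => ?_⟩
  by_contra hn
  have h1 : 1 ≤ (collisions b (b - l) a S).card :=
    Finset.card_pos.2 ⟨(x, y), Finset.mem_filter.2 ⟨Finset.mem_offDiag.2 ⟨hx, hy, hn⟩, hxy⟩⟩
  have h2 : 2 ^ (b - 1) ≤ (S.card * S.card - S.card) * 2 ^ (b - l) :=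
    (Nat.le_mul_of_pos_left _ h1).trans h
  -- The average number of colliding ordered pairs is at most `2 * (|S|^2 - |S|) / 2^l`. Leaving out
  -- the diagonal makes this strictly less than one.
  have h3 : 2 * (S.card * S.card - S.card) < 2 ^ l := by
    have : 0 < S.card := hne.card_pos
    have h4 : S.card ≤ S.card * S.card := Nat.le_mul_self _
    rw [pow_two] at hc
    omega
  have h5 : 2 ^ b ≤ 2 * (S.card * S.card - S.card) * 2 ^ (b - l) := by
    calc 2 ^ b = 2 * 2 ^ (b - 1) := by rw [← pow_succ', Nat.sub_add_cancel hb]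
      _ ≤ _ := by rw [mul_assoc]; exact Nat.mul_le_mul_left _ h2
  have h6 : 2 * (S.card * S.card - S.card) * 2 ^ (b - l) < 2 ^ l * 2 ^ (b - l) :=
    Nat.mul_lt_mul_of_pos_right h3 (by positivity)
  rw [← pow_add, Nat.add_sub_cancel' hl] at h6
  omega

/-- Static dictionaries: a set of at most `2 ^ m` keys is mapped injectively into a table
of `2 ^ (m + 4)` cells by two-level hashing. -/
theorem exists_perfectHash {b m : ℕ} (hm : m + 3 ≤ b) (S : Finset ℕ) (hS : ∀ x ∈ S, x < 2 ^ b)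
    (hc : S.card ≤ 2 ^ m) :
    ∃ (a : ℕ) (A s o : ℕ → ℕ), a < 2 ^ b ∧ (∀ h, A h < 2 ^ b) ∧ (∀ h, s h ≤ b) ∧
      Set.InjOn (fun x => o (msHash b (b - m) a x) +
        msHash b (s (msHash b (b - m) a x)) (A (msHash b (b - m) a x)) x) S ∧
      ∀ x, o (msHash b (b - m) a x) +
        msHash b (s (msHash b (b - m) a x)) (A (msHash b (b - m) a x)) x < 2 ^ (m + 4) := by
  have hb : 1 ≤ b := by omega
  obtain ⟨a, ha, hcoll⟩ := exists_few_collisions (b - m) hb S hS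
  set h : ℕ → ℕ := msHash b (b - m) a with hh
  have hlt : ∀ x, h x < 2 ^ m := fun x => by
    simpa [Nat.sub_sub_self (show m ≤ b by omega)] using
      msHash_lt (b := b) (s := b - m) (a := a) (x := x) (by omega)
  set F : ℕ → Finset ℕ := fun i => {x ∈ S | h x = i} with hF
  have hcard : (collisions b (b - m) a S).card ≤ 2 * 2 ^ m := by
    have h1 : (S.card * S.card - S.card) * 2 ^ (b - m) ≤ 2 ^ m * 2 ^ m * 2 ^ (b - m) :=
      Nat.mul_le_mul_right _ ((Nat.sub_le _ _).trans (Nat.mul_le_mul hc hc))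
    have h2 : 2 ^ m * 2 ^ m * 2 ^ (b - m) = 2 * 2 ^ m * 2 ^ (b - 1) := by
      rw [← pow_add, ← pow_add, ← pow_succ', ← pow_add]; congr 1; omega
    rw [h2] at h1
    exact Nat.le_of_mul_le_mul_right (hcoll.trans h1) (by positivity)
  -- The sum counts the ordered pairs with equal first-level hash: at most `2^m` diagonal ones and
  -- `2 * 2^m` collisions.
  have hsq : ∑ i ∈ Finset.range (2 ^ m), (F i).card ^ 2 ≤ 3 * 2 ^ m := by
    have h1 : ∑ i ∈ Finset.range (2 ^ m), (F i).card ^ 2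
        = ({q ∈ S ×ˢ S | h q.1 = h q.2}).card := by
      rw [Finset.card_eq_sum_card_fiberwise (f := fun q : ℕ × ℕ => h q.1)
        (t := Finset.range (2 ^ m)) fun q _ => by simpa using hlt q.1]
      refine Finset.sum_congr rfl fun i _ => ?_
      rw [pow_two, ← Finset.card_product]
      congr 1
      ext ⟨x, y⟩
      simp only [hF, Finset.mem_product, Finset.mem_filter]
      constructor
      · rintro ⟨⟨hx, rfl⟩, hy, hxy⟩
        exact ⟨⟨⟨hx, hy⟩, hxy.symm⟩, rfl⟩
      · rintro ⟨⟨⟨hx, hy⟩, hxy⟩, rfl⟩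
        exact ⟨⟨hx, rfl⟩, hy, hxy.symm⟩
    have h2 : ({q ∈ S ×ˢ S | h q.1 = h q.2}) ⊆ S.diag ∪ collisions b (b - m) a S := by
      intro q hq
      obtain ⟨hq, he⟩ := Finset.mem_filter.1 hq
      obtain ⟨hx, hy⟩ := Finset.mem_product.1 hq
      by_cases hxy : q.1 = q.2
      · exact Finset.mem_union_left _ (Finset.mem_diag.2 ⟨hx, hxy⟩)
      · exact Finset.mem_union_right _
          (Finset.mem_filter.2 ⟨Finset.mem_offDiag.2 ⟨hx, hy, hxy⟩, he⟩)
    rw [h1]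
    refine (Finset.card_le_card h2).trans ((Finset.card_union_le _ _).trans ?_)
    rw [Finset.diag_card]
    omega
  -- A bucket gets the least power of two that is at least `2 * |F i|^2`; an empty bucket still gets
  -- one cell, hence the `+ 1` in `hlF`. In total there are at most `4 * 3 * 2^m + 2^m = 13 * 2^m`
  -- cells, which fit into `2^(m+4)`.
  set l : ℕ → ℕ := fun i => if i < 2 ^ m then Nat.clog 2 (2 * (F i).card ^ 2) else 0 with hl
  have hlb : ∀ i, l i ≤ b := fun i => by
    simp only [hl]
    split_ifs with hi
    · refine (Nat.clog_le_iff_le_pow (by norm_num)).2 ?_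
      have h1 : (F i).card ^ 2 ≤ 3 * 2 ^ m :=
        (Finset.single_le_sum (f := fun i => (F i).card ^ 2) (fun _ _ => Nat.zero_le _)
          (Finset.mem_range.2 hi)).trans hsq
      have h2 : 2 ^ (m + 3) ≤ 2 ^ b := Nat.pow_le_pow_right (by norm_num) hm
      rw [pow_add] at h2
      omega
    · exact Nat.zero_le _
  have hlF : ∀ i < 2 ^ m, 2 ^ l i ≤ 4 * (F i).card ^ 2 + 1 := fun i hi => by
    simp only [hl, if_pos hi]
    rcases Nat.eq_zero_or_pos (F i).card with h0 | h0
    · simp [h0]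
    · have h1 : 1 < 2 * (F i).card ^ 2 := by nlinarith
      have := Nat.pow_pred_clog_lt_self (b := 2) (by norm_num) h1
      have h2 : 0 < Nat.clog 2 (2 * (F i).card ^ 2) := Nat.clog_pos (by norm_num) h1
      rw [← Nat.succ_pred_eq_of_pos h2, pow_succ]
      omega
  have hex : ∀ i, ∃ A < 2 ^ b, i < 2 ^ m → Set.InjOn (msHash b (b - l i) A) (F i) := fun i => by
    by_cases hi : i < 2 ^ m
    · obtain ⟨A, hA, h1⟩ := exists_injOn_msHash (hlb i) hb (F i)
        (fun x hx => hS x (Finset.mem_filter.1 hx).1) (by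
          simp only [hl, if_pos hi]
          exact Nat.le_pow_clog (by norm_num) _)
      exact ⟨A, hA, fun _ => h1⟩
    · exact ⟨0, by positivity, fun h => absurd h hi⟩
  choose A hA hinj using hex
  set o : ℕ → ℕ := fun i => ∑ j ∈ Finset.range i, 2 ^ l j with ho
  have hcell : ∀ i x, msHash b (b - l i) (A i) x < 2 ^ l i := fun i x => by
    simpa [Nat.sub_sub_self (hlb i)] using
      msHash_lt (b := b) (s := b - l i) (a := A i) (x := x) (by omega)
  have hmono : Monotone o := fun i j hij => Finset.sum_le_sum_of_subset (by simpa using hij)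
  have hstep : ∀ i x, o i + msHash b (b - l i) (A i) x < o (i + 1) := fun i x => by
    simp only [ho, Finset.sum_range_succ]
    exact Nat.add_lt_add_left (hcell i x) _
  refine ⟨a, A, fun i => b - l i, o, ha, hA, fun i => Nat.sub_le _ _, ?_, fun x => ?_⟩
  · intro x hx y hy hxy
    replace hxy : o (h x) + msHash b (b - l (h x)) (A (h x)) x
        = o (h y) + msHash b (b - l (h y)) (A (h y)) y := hxy
    have hhe : h x = h y := by
      rcases lt_trichotomy (h x) (h y) with hlt' | he | hlt'
      · have := hstep (h x) x
        have := hmono (show h x + 1 ≤ h y from hlt')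
        omega
      · exact he
      · have := hstep (h y) y
        have := hmono (show h y + 1 ≤ h x from hlt')
        omega
    rw [hhe] at hxy
    exact hinj (h y) (hlt y) (Finset.mem_coe.2 (Finset.mem_filter.2 ⟨hx, hhe⟩))
      (Finset.mem_coe.2 (Finset.mem_filter.2 ⟨hy, rfl⟩)) (Nat.add_left_cancel hxy)
  · refine (hstep (h x) x).trans_le ((hmono (show h x + 1 ≤ 2 ^ m from hlt x)).trans ?_)
    calc o (2 ^ m) ≤ ∑ i ∈ Finset.range (2 ^ m), (4 * (F i).card ^ 2 + 1) :=
          Finset.sum_le_sum fun i hi => hlF i (Finset.mem_range.1 hi)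
      _ = 4 * ∑ i ∈ Finset.range (2 ^ m), (F i).card ^ 2 + 2 ^ m := by
          rw [Finset.sum_add_distrib, ← Finset.mul_sum]; simp
      _ ≤ 2 ^ (m + 4) := by rw [pow_add]; omega

/-! ### Prefixes of bit streams -/

theorem padded_eq_getElem {l : List Bool} {j : ℕ} (h : j < l.length) : padded l j = l[j] := by
  simp [padded, List.getD_eq_getElem?_getD, h]

theorem padded_of_length_le {l : List Bool} {j : ℕ} (h : l.length ≤ j) : padded l j = false := by
  simp [padded, List.getD_eq_getElem?_getD, h]

/-- The stream `s` begins with the bit string `l`. -/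
def StartsWith (l : List Bool) (s : ℕ → Bool) : Prop := ∀ j < l.length, s j = padded l j

theorem startsWith_padded (l : List Bool) : StartsWith l (padded l) := fun _ _ => rfl

theorem StartsWith.isPrefix {l l' : List Bool} {s : ℕ → Bool} (h : StartsWith l s)
    (h' : StartsWith l' s) (hl : l.length ≤ l'.length) : l <+: l' := by
  rw [List.prefix_iff_getElem]
  refine ⟨hl, fun j hj => ?_⟩
  rw [← padded_eq_getElem hj, ← padded_eq_getElem (hj.trans_le hl), ← h j hj,
    ← h' j (hj.trans_le hl)]

/-- Two codewords that begin the same stream are comparable as prefixes. This is what makes every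
lookup by stream unambiguous. -/
theorem IsPrefixCode.eq_of_startsWith {n : ℕ} {code : Fin n → List Bool} (hc : IsPrefixCode code)
    {i j : Fin n} {s : ℕ → Bool} (hi : StartsWith (code i) s) (hj : StartsWith (code j) s) :
    i = j := by
  by_contra hij
  rcases le_total (code i).length (code j).length with h | h
  · exact hc i j hij (hi.isPrefix hj h)
  · exact hc j i (Ne.symm hij) (hj.isPrefix hi h)

theorem IsPrefixCode.length_pos {n : ℕ} {code : Fin n → List Bool} (hc : IsPrefixCode code)
    (hn : 2 ≤ n) (i : Fin n) : 1 ≤ (code i).length := by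
  by_contra! h
  have : Nontrivial (Fin n) := Fin.nontrivial_iff_two_le.2 hn
  obtain ⟨j, hj⟩ := exists_ne i
  exact hc i j hj.symm (by rw [List.length_eq_zero_iff.1 (by omega : (code i).length = 0)]; simp)

/-- A prefix code has at most `2 ^ m` codewords of length at most `m`. -/
theorem IsPrefixCode.card_le {n m : ℕ} {code : Fin n → List Bool} (hc : IsPrefixCode code)
    (S : Finset (Fin n)) (hS : ∀ i ∈ S, (code i).length ≤ m) : S.card ≤ 2 ^ m := by
  have : S.card ≤ (Finset.univ : Finset (Fin m → Bool)).card := by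
    refine Finset.card_le_card_of_injOn (fun i j => padded (code i) j) (by simp) ?_
    intro i hi j hj hij
    refine hc.eq_of_startsWith (startsWith_padded (code i)) fun k hk => ?_
    exact congrFun hij ⟨k, hk.trans_le (hS j hj)⟩
  simpa using this

/-! ### Optimal codes -/

/-- The unit vectors of length `n` form a prefix code. Hence the infimum in `optAvgLength` is taken
over a nonempty set. -/
theorem exists_isPrefixCode (n : ℕ) : ∃ code : Fin n → List Bool, IsPrefixCode code := by
  refine ⟨fun i => List.ofFn fun j : Fin n => decide (j = i), fun i j hij h => hij ?_⟩
  have := List.ofFn_injective (h.eq_of_length (by simp))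
  simpa using congrFun this i

/-- The optimal average length is attained, and among the optimal codes there is one whose
total length is minimal. -/
theorem exists_optimal_code {n : ℕ} (p : Fin n → ℝ) (hp : ∀ i, 0 ≤ p i) :
    ∃ code : Fin n → List Bool, IsPrefixCode code ∧ avgLength p code = optAvgLength p ∧
      ∀ code' : Fin n → List Bool, IsPrefixCode code' → (∀ i, (code' i).length ≤ (code i).length) →
        ∑ i, (code i).length ≤ ∑ i, (code' i).length := by
  set X : Set ℝ := {x : ℝ | ∃ code : Fin n → List Bool, IsPrefixCode code ∧ x = avgLength p code}
    with hX
  have hne : X.Nonempty := by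
    obtain ⟨code, h⟩ := exists_isPrefixCode n
    exact ⟨_, code, h, rfl⟩
  have hmono : Monotone fun l : Fin n → ℕ => ∑ i, p i * (l i : ℝ) := fun l l' h =>
    Finset.sum_le_sum fun i _ => mul_le_mul_of_nonneg_left (Nat.cast_le.2 (h i)) (hp i)
  have hwf : X.IsWF := by
    have hsub : X ⊆ Set.range fun l : Fin n → ℕ => ∑ i, p i * (l i : ℝ) := by
      rintro _ ⟨code, -, rfl⟩
      exact ⟨fun i => (code i).length, rfl⟩
    refine Set.IsWF.mono ?_ hsub
    rw [← Set.image_univ]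
    -- Dickson's lemma: vectors of lengths are well-quasi-ordered, and a monotone real-valued image
    -- is then well-founded. No positivity of the weights is needed.
    exact ((Set.isPWO_of_wellQuasiOrderedLE _).image_of_monotone hmono).isWF
  have hmin : ∀ x ∈ X, hwf.min hne ≤ x := fun x hx => hwf.min_le hne hx
  have hopt : optAvgLength p = hwf.min hne :=
    IsLeast.csInf_eq ⟨hwf.min_mem hne, hmin⟩
  obtain ⟨code₀, h₀, hv₀⟩ := hwf.min_mem hne
  -- A symbol of weight zero may have an arbitrarily long codeword in an optimal code, so the total
  -- length is minimised as well.
  have hex : ∃ N, ∃ code : Fin n → List Bool, IsPrefixCode code ∧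
      avgLength p code = hwf.min hne ∧ ∑ i, (code i).length = N := ⟨_, code₀, h₀, hv₀.symm, rfl⟩
  classical
  obtain ⟨code, h1, h2, h3⟩ := Nat.find_spec hex
  refine ⟨code, h1, h2.trans hopt.symm, fun code' h' hle => ?_⟩
  rw [h3]
  refine Nat.find_min' hex ⟨code', h', le_antisymm ?_ (hmin _ ⟨code', h', rfl⟩), rfl⟩
  rw [← h2]
  exact hmono hle

/-- In a code of minimal total length the codewords are shorter than the number of symbols. -/
theorem IsPrefixCode.length_lt_of_minimal {n : ℕ} {code : Fin n → List Bool}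
    (hc : IsPrefixCode code)
    (hmin : ∀ code' : Fin n → List Bool, IsPrefixCode code' →
      (∀ i, (code' i).length ≤ (code i).length) →
        ∑ i, (code i).length ≤ ∑ i, (code' i).length) (i : Fin n) :
    (code i).length < n := by
  -- At each position of the codeword some other codeword must branch off: otherwise the bit at that
  -- position could be deleted from all codewords passing through it. The branching symbols differ
  -- from `i` and from each other, which gives `(code i).length + 1` symbols.
  have hsib : ∀ j : Fin (code i).length, ∃ k,
      (code i).take j ++ [!(code i)[j]] <+: code k := by
    intro j
    by_contra! hno
    set u := (code i).take j with hu
    set b := (code i)[j] with hb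
    have hub : u ++ [b] <+: code i := by
      rw [hu, hb, Fin.getElem_fin, List.take_concat_get']
      exact List.take_prefix _ _
    -- A codeword equal to `u` would be a proper prefix of `code i`, and none continues with the
    -- opposite bit.
    have hbr : ∀ k, u <+: code k → u ++ [b] <+: code k := by
      rintro k ⟨z, hz⟩
      rcases z with _ | ⟨a, z⟩
      · rw [List.append_nil] at hz
        have h1 : code k <+: code i := hz ▸ (List.prefix_append u [b]).trans hub
        have h2 : k = i := by
          by_contra h
          exact hc k i h h1
        have := hub.length_le
        rw [← h2, ← hz, List.length_append] at this
        simp at this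
      · rcases eq_or_ne a b with rfl | hab
        · exact ⟨z, by simpa using hz⟩
        · have : a = !b := Bool.eq_not_of_ne hab
          exact absurd ⟨z, by simpa [this] using hz⟩ (hno k)
    classical
    set f : List Bool → List Bool := fun l =>
      if u ++ [b] <+: l then u ++ l.drop (u.length + 1) else l with hf
    have hunder : ∀ k, u ++ [b] <+: code k →
        ∃ z, code k = u ++ b :: z ∧ f (code k) = u ++ z := by
      rintro k ⟨z, hz⟩
      refine ⟨z, by simp [← hz], ?_⟩
      simp only [hf, if_pos (show u ++ [b] <+: code k from ⟨z, hz⟩)]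
      rw [← hz, List.drop_append_of_le_length (by simp), List.drop_of_length_le (by simp)]
      simp
    have hother : ∀ k, ¬ (u ++ [b] <+: code k) → f (code k) = code k := fun k hk => by
      simp only [hf, if_neg hk]
    have hpre : IsPrefixCode fun k => f (code k) := by
      intro k l hkl hp
      simp only at hp
      by_cases hk : u ++ [b] <+: code k <;> by_cases hl : u ++ [b] <+: code l
      · obtain ⟨x, hx, hx'⟩ := hunder k hk
        obtain ⟨y, hy, hy'⟩ := hunder l hl
        rw [hx', hy', List.prefix_append_right_inj] at hp
        refine hc k l hkl ?_
        rw [hx, hy, List.prefix_append_right_inj, List.cons_prefix_cons]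
        exact ⟨rfl, hp⟩
      · obtain ⟨x, hx, hx'⟩ := hunder k hk
        rw [hx', hother l hl] at hp
        exact hl (hbr l ((List.prefix_append u x).trans hp))
      · obtain ⟨y, hy, hy'⟩ := hunder l hl
        rw [hy', hother k hk] at hp
        rcases List.prefix_or_prefix_of_prefix hp (List.prefix_append u y) with h | h
        · exact hc k l hkl (h.trans (hy ▸ List.prefix_append u _))
        · exact hk (hbr k h)
      · rw [hother k hk, hother l hl] at hp
        exact hc k l hkl hp
    have hle : ∀ k, (f (code k)).length ≤ (code k).length := fun k => by
      by_cases hk : u ++ [b] <+: code k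
      · obtain ⟨x, hx, hx'⟩ := hunder k hk
        rw [hx', hx]; simp
      · rw [hother k hk]
    refine absurd (hmin _ hpre hle) (not_le.2 (Finset.sum_lt_sum (fun k _ => hle k)
      ⟨i, Finset.mem_univ i, ?_⟩))
    obtain ⟨x, hx, hx'⟩ := hunder i hub
    rw [hx', hx]; simp
  choose σ hσ using hsib
  have hlt : ∀ j : Fin (code i).length, (j : ℕ) < (code (σ j)).length ∧
      padded (code (σ j)) j = !padded (code i) j := fun j => by
    have h1 := (hσ j).length_le
    have h2 : (j : ℕ) < ((code i).take j ++ [!(code i)[j]]).length := by simp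
    have h3 := (hσ j).getElem h2
    have h4 : ((code i).take j ++ [!(code i)[j]])[(j : ℕ)]'h2 = !(code i)[j] := by
      rw [List.getElem_append_right (by simp)]; simp
    refine ⟨h2.trans_le h1, ?_⟩
    rw [padded_eq_getElem (h2.trans_le h1), padded_eq_getElem j.2, ← h3, h4]
    rfl
  have hagree : ∀ (j : Fin (code i).length) (k : ℕ), k < j →
      padded (code (σ j)) k = padded (code i) k := fun j k hk => by
    have h2 : k < ((code i).take j ++ [!(code i)[j]]).length := by simp; omega
    have h3 := (hσ j).getElem h2
    rw [padded_eq_getElem (h2.trans_le (hσ j).length_le), padded_eq_getElem (hk.trans j.2), ← h3,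
      List.getElem_append_left (by simp; omega), List.getElem_take]
  -- At the smaller of two positions one of the branching codewords deviates from `code i`, while
  -- the other still agrees with it.
  have hinj : Function.Injective σ := fun j j' h => by
    by_contra hne
    rcases lt_or_gt_of_ne hne with hlt' | hlt'
    · have h1 := (hlt j).2
      rw [h, hagree j' j hlt'] at h1
      cases h2 : padded (code i) j <;> simp [h2] at h1
    · have h1 := (hlt j').2
      rw [← h, hagree j j' hlt'] at h1
      cases h2 : padded (code i) j' <;> simp [h2] at h1
  have hni : ∀ j, σ j ≠ i := fun j h => by
    have h1 := (hlt j).2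
    rw [h] at h1
    cases h2 : padded (code i) j <;> simp [h2] at h1
  have hcard : (Finset.univ.image σ).card < (Finset.univ : Finset (Fin n)).card :=
    Finset.card_lt_card ⟨Finset.subset_univ _, fun h => by
      obtain ⟨j, -, hj⟩ := Finset.mem_image.1 (h (Finset.mem_univ i))
      exact hni j hj⟩
  rw [Finset.card_image_of_injective _ hinj] at hcard
  simpa using hcard

/-! ### Codes with an escape codeword -/

/-- The `b` low bits of `a`, the most significant one first. -/
def bitList (b a : ℕ) : List Bool := List.ofFn fun j : Fin b => a.testBit (b - 1 - j)

@[simp] theorem length_bitList (b a : ℕ) : (bitList b a).length = b := by simp [bitList]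

theorem padded_bitList {b a j : ℕ} (h : j < b) :
    padded (bitList b a) j = a.testBit (b - 1 - j) := by
  rw [padded_eq_getElem (by simpa using h)]
  simp [bitList]

theorem bitList_injOn {b x y : ℕ} (hx : x < 2 ^ b) (hy : y < 2 ^ b)
    (h : bitList b x = bitList b y) : x = y := by
  refine Nat.eq_of_testBit_eq fun j => ?_
  by_cases hj : j < b
  · have h1 := padded_bitList (b := b) (a := x) (show b - 1 - j < b by omega)
    rw [h, padded_bitList (by omega), show b - 1 - (b - 1 - j) = j by omega] at h1
    exact h1.symm
  · have : 2 ^ b ≤ 2 ^ j := Nat.pow_le_pow_right (by norm_num) (by omega)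
    rw [Nat.testBit_lt_two_pow (by omega), Nat.testBit_lt_two_pow (by omega)]

/-- Every prefix code can be changed so that the codewords longer than `t` all consist of an
escape codeword of length `K + 1` followed by the symbol, while the other codewords grow by at
most one bit, and this only if they have at least `K` bits. -/
theorem IsPrefixCode.exists_escape {n K t b : ℕ} {code : Fin n → List Bool}
    (hc : IsPrefixCode code) (hK : K ≤ t) (hb : n ≤ 2 ^ b) :
    ∃ (code' : Fin n → List Bool) (S : Finset (Fin n)) (e : List Bool), IsPrefixCode code' ∧
      e.length = K + 1 ∧ (∀ i ∈ S, (code' i).length ≤ t + 1) ∧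
      (∀ i ∉ S, code' i = e ++ bitList b i) ∧
      ∀ i, (code' i).length ≤ (code i).length ∨
        (K ≤ (code i).length ∧ (code' i).length ≤ (code i).length + 1) ∨
        (t < (code i).length ∧ (code' i).length = K + 1 + b) := by
  classical
  by_cases hlong : ∃ i, t < (code i).length
  swap
  · push Not at hlong
    -- Without long codewords the code is kept. The escape word is never used, and only its length
    -- matters.
    exact ⟨code, Finset.univ, List.replicate (K + 1) false, hc, by simp,
      fun i _ => (hlong i).trans (Nat.le_succ t), fun i hi => absurd (Finset.mem_univ i) hi,
      fun i => .inl le_rfl⟩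
  obtain ⟨i₀, hi₀⟩ := hlong
  set u := (code i₀).take K with hu
  have hulen : u.length = K := by simp [hu]; omega
  -- A codeword that is a prefix of `u` would be a prefix of `code i₀`, hence equal to it, but that
  -- one has more than `t ≥ K` bits.
  have hnot : ∀ j, ¬ (code j <+: u) := fun j hj => by
    have h1 : j = i₀ := by
      by_contra h
      exact hc j i₀ h (hj.trans (List.take_prefix _ _))
    have := hj.length_le
    rw [h1, hulen] at this
    omega
  -- The subtree at `u` is moved to its child `true`; the child `false` becomes the escape word.
  set f : List Bool → List Bool := fun l =>
    if u <+: l then u ++ true :: l.drop u.length else l with hf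
  have hunder : ∀ k, u <+: code k → ∃ z, code k = u ++ z ∧ f (code k) = u ++ true :: z := by
    rintro k ⟨z, hz⟩
    refine ⟨z, hz.symm, ?_⟩
    simp only [hf, if_pos (show u <+: code k from ⟨z, hz⟩)]
    rw [← hz]; simp
  have hother : ∀ k, ¬ (u <+: code k) → f (code k) = code k := fun k hk => by
    simp only [hf, if_neg hk]
  have hincomp : ∀ k, ¬ (u <+: code k) → ∀ z, ¬ (code k <+: u ++ z) := fun k hk z hz => by
    rcases List.prefix_or_prefix_of_prefix hz (List.prefix_append u z) with h | h
    · exact hnot k h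
    · exact hk h
  set S : Finset (Fin n) := {i | (code i).length ≤ t} with hS
  have hlen : ∀ i, (f (code i)).length ≤ (code i).length ∨
      (K ≤ (code i).length ∧ (f (code i)).length ≤ (code i).length + 1) := fun i => by
    by_cases hi : u <+: code i
    · obtain ⟨z, hz, hz'⟩ := hunder i hi
      refine .inr ⟨hulen ▸ hi.length_le, ?_⟩
      rw [hz', hz]; simp; omega
    · exact .inl (by rw [hother i hi])
  refine ⟨fun i => if i ∈ S then f (code i) else (u ++ [false]) ++ bitList b i, S, u ++ [false],
    ?_, by simp [hulen], fun i hi => ?_, fun i hi => if_neg hi, fun i => ?_⟩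
  · intro i j hij hp
    simp only at hp
    by_cases hi : i ∈ S <;> by_cases hj : j ∈ S
    · rw [if_pos hi, if_pos hj] at hp
      by_cases hi' : u <+: code i
      · obtain ⟨x, hx, hx'⟩ := hunder i hi'
        by_cases hj' : u <+: code j
        · obtain ⟨y, hy, hy'⟩ := hunder j hj'
          rw [hx', hy', List.prefix_append_right_inj, List.cons_prefix_cons] at hp
          refine hc i j hij ?_
          rw [hx, hy, List.prefix_append_right_inj]
          exact hp.2
        · rw [hx', hother j hj'] at hp
          exact hj' ((List.prefix_append u _).trans hp)
      · rw [hother i hi'] at hp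
        by_cases hj' : u <+: code j
        · obtain ⟨y, hy, hy'⟩ := hunder j hj'
          exact hincomp i hi' _ (hy' ▸ hp)
        · exact hc i j hij (hother j hj' ▸ hp)
    · rw [if_pos hi, if_neg hj, List.append_assoc] at hp
      by_cases hi' : u <+: code i
      · obtain ⟨x, hx, hx'⟩ := hunder i hi'
        rw [hx', List.prefix_append_right_inj, List.singleton_append,
          List.cons_prefix_cons] at hp
        exact absurd hp.1 (by simp)
      · exact hincomp i hi' _ (hother i hi' ▸ hp)
    · rw [if_neg hi, if_pos hj, List.append_assoc] at hp
      by_cases hj' : u <+: code j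
      · obtain ⟨y, hy, hy'⟩ := hunder j hj'
        rw [hy', List.prefix_append_right_inj, List.singleton_append,
          List.cons_prefix_cons] at hp
        exact absurd hp.1 (by simp)
      · rw [hother j hj'] at hp
        exact hj' ((List.prefix_append u _).trans hp)
    · rw [if_neg hi, if_neg hj, List.prefix_append_right_inj] at hp
      exact hij (Fin.ext (bitList_injOn (i.2.trans_le hb) (j.2.trans_le hb)
        (hp.eq_of_length (by simp))))
  · have hi' : (code i).length ≤ t := by simpa [hS] using hi
    simp only [if_pos hi]
    rcases hlen i with h | h <;> omega
  · by_cases hi : i ∈ S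
    · simp only [if_pos hi]
      rcases hlen i with h | h
      · exact .inl h
      · exact .inr (.inl h)
    · have hi' : t < (code i).length := by simpa [hS] using hi
      simp only [if_neg hi]
      exact .inr (.inr ⟨hi', by simp [hulen]; omega⟩)

/-! ### Reading bits from packed words -/

theorem testBit_packWord (w : ℕ) (s : ℕ → Bool) (q m : ℕ) :
    (packWord w s q).toNat.testBit m = (decide (m < w) && s (q * w + (w - 1 - m))) := by
  rw [packWord, BitVec.toNat_ofFnBE]
  by_cases h : m < w
  · rw [Nat.testBit_ofBits_lt _ _ h]
    simp only [Function.comp, h, decide_true, Bool.true_and, Fin.val_rev]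
    congr 2
    omega
  · rw [Nat.testBit_ofBits_ge _ _ (by omega)]
    simp [h]

/-- The number with `b` binary digits that stands at position `i` of a bit sequence. -/
def readBits (s : ℕ → Bool) (i b : ℕ) : ℕ := (packWord b (fun j => s (i + j)) 0).toNat

theorem testBit_readBits (s : ℕ → Bool) (i b m : ℕ) :
    (readBits s i b).testBit m = (decide (m < b) && s (i + (b - 1 - m))) := by
  simp [readBits, testBit_packWord]

theorem readBits_lt (s : ℕ → Bool) (i b : ℕ) : readBits s i b < 2 ^ b := BitVec.isLt _

theorem eq_readBits {s : ℕ → Bool} {i b a : ℕ} (ha : a < 2 ^ b)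
    (h : ∀ m < b, a.testBit m = s (i + (b - 1 - m))) : a = readBits s i b := by
  refine Nat.eq_of_testBit_eq fun m => ?_
  rw [testBit_readBits]
  by_cases hm : m < b
  · simp [hm, h m hm]
  · have : 2 ^ b ≤ 2 ^ m := Nat.pow_le_pow_right (by norm_num) (by omega)
    rw [Nat.testBit_lt_two_pow (by omega)]
    simp [hm]

theorem packWord_eq_readBits (w : ℕ) (s : ℕ → Bool) (q : ℕ) :
    (packWord w s q).toNat = readBits s (q * w) w := by
  refine eq_readBits (BitVec.isLt _) fun m hm => ?_
  rw [testBit_packWord]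
  simp [hm]

/-- Two shifts cut a field out of a word. -/
theorem shift_packWord {w r b : ℕ} (s : ℕ → Bool) (q : ℕ) (h : r + b ≤ w) :
    (packWord w s q).toNat * 2 ^ r % 2 ^ w / 2 ^ (w - b) = readBits s (q * w + r) b := by
  refine eq_readBits ?_ fun m hm => ?_
  · rw [Nat.div_lt_iff_lt_mul (by positivity), ← pow_add, Nat.add_sub_cancel' (by omega)]
    exact Nat.mod_lt _ (by positivity)
  · rw [Nat.testBit_div_two_pow, Nat.testBit_mod_two_pow, Nat.testBit_mul_two_pow,
      testBit_packWord]
    simp only [show m + (w - b) < w by omega, show r ≤ m + (w - b) by omega,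
      show m + (w - b) - r < w by omega, decide_true, Bool.true_and]
    congr 1
    omega

theorem padded_append_left {l l' : List Bool} {j : ℕ} (h : j < l.length) :
    padded (l ++ l') j = padded l j := by
  simp [padded, List.getD_eq_getElem?_getD, List.getElem?_append_left h]

theorem padded_append_right (l l' : List Bool) (j : ℕ) :
    padded (l ++ l') (l.length + j) = padded l' j := by
  simp [padded, List.getD_eq_getElem?_getD, List.getElem?_append_right]

/-! ### Arrays of fields in memory -/

/-- The bits of an array `G` of fields of `b` bits, with `w / b` fields to a word. -/
def fieldBit (w b : ℕ) (G : ℕ → ℕ) (x : ℕ) : Bool :=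
  decide (x % w / b < w / b) && (G (x / w * (w / b) + x % w / b)).testBit (b - 1 - x % w % b)

/-- The bit string that holds the first `N` fields of `G`. -/
def fieldString (w b N : ℕ) (G : ℕ → ℕ) : List Bool :=
  List.ofFn fun x : Fin (N / (w / b) * w + N % (w / b) * b) => fieldBit w b G x

/-- Unused bits fill at most half of a word, so the full words take at most `2 * N * b` bits. The
last, partial word has no gaps and takes at most `N * b`. -/
theorem length_fieldString_le {w b N : ℕ} {G : ℕ → ℕ} (hb : 1 ≤ b) (hbw : b ≤ w) :
    (fieldString w b N G).length ≤ 3 * N * b := by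
  have hf : 1 ≤ w / b := (Nat.one_le_div_iff hb).2 hbw
  have h1 : w ≤ 2 * (w / b * b) := by
    have := Nat.mod_add_div w b
    have := Nat.mod_lt w hb
    have : b ≤ w / b * b := Nat.le_mul_of_pos_left _ hf
    rw [mul_comm] at this ⊢
    rw [mul_comm (w / b)] at *
    omega
  have h2 : N / (w / b) * w ≤ 2 * N * b :=
    calc N / (w / b) * w ≤ N / (w / b) * (2 * (w / b * b)) := Nat.mul_le_mul_left _ h1
      _ = 2 * (N / (w / b) * (w / b)) * b := by ring
      _ ≤ 2 * N * b := Nat.mul_le_mul_right _ (Nat.mul_le_mul_left _ (Nat.div_mul_le_self _ _))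
  have h3 : N % (w / b) * b ≤ N * b := Nat.mul_le_mul_right _ (Nat.mod_le _ _)
  simp only [fieldString, List.length_ofFn]
  linarith

/-- Every bit beyond the string belongs to a field with index at least `N` or to a gap, and is zero.
So the stored string can be treated as the unbounded array. -/
theorem padded_fieldString {w b N : ℕ} {G : ℕ → ℕ} (hb : 1 ≤ b) (hbw : b ≤ w)
    (hG : ∀ j, N ≤ j → G j = 0) : padded (fieldString w b N G) = fieldBit w b G := by
  have hf : 1 ≤ w / b := (Nat.one_le_div_iff hb).2 hbw
  funext x
  by_cases hx : x < N / (w / b) * w + N % (w / b) * b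
  · rw [padded_eq_getElem (by simpa [fieldString] using hx)]
    simp [fieldString]
  · rw [padded_of_length_le (by simpa [fieldString] using hx)]
    have hidx : N ≤ x / w * (w / b) + x % w / b := by
      have hN := Nat.div_add_mod N (w / b)
      rw [mul_comm] at hN
      have hxw := Nat.div_add_mod x w
      rw [mul_comm] at hxw
      have hr := Nat.mod_lt x (show 0 < w by omega)
      rcases lt_trichotomy (x / w) (N / (w / b)) with h | h | h
      · have h1 : (x / w + 1) * w ≤ N / (w / b) * w := Nat.mul_le_mul_right _ h
        rw [Nat.add_mul] at h1
        omega
      · have h1 : N % (w / b) ≤ x % w / b := by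
          rw [Nat.le_div_iff_mul_le hb]
          rw [h] at hxw
          omega
        rw [h]
        omega
      · have h1 : (N / (w / b) + 1) * (w / b) ≤ x / w * (w / b) := Nat.mul_le_mul_right _ h
        rw [Nat.add_mul] at h1
        have := Nat.mod_lt N hf
        have := Nat.zero_le (x % w / b)
        omega
    simp [fieldBit, hG _ hidx]

theorem readBits_fieldBit {w b : ℕ} {G : ℕ → ℕ} (hG : ∀ j, G j < 2 ^ b) (q : ℕ) {j : ℕ}
    (hj : j < w / b) : readBits (fieldBit w b G) (q * w + j * b) b = G (q * (w / b) + j) := by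
  symm
  refine eq_readBits (hG _) fun m hm => ?_
  have h1 : (j + 1) * b ≤ w := (Nat.mul_le_mul_right _ hj).trans (Nat.div_mul_le_self _ _)
  rw [Nat.add_mul] at h1
  have h2 : j * b + (b - 1 - m) < w := by omega
  have h3 : (q * w + j * b + (b - 1 - m)) % w = j * b + (b - 1 - m) := by
    rw [add_assoc, Nat.mul_add_mod_self_right, Nat.mod_eq_of_lt h2]
  have h4 : (q * w + j * b + (b - 1 - m)) / w = q := by
    rw [add_assoc, mul_comm, Nat.mul_add_div (by omega), Nat.div_eq_of_lt h2, add_zero]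
  have h5 : (j * b + (b - 1 - m)) / b = j := by
    rw [mul_comm, Nat.mul_add_div (by omega), Nat.div_eq_of_lt (by omega), add_zero]
  have h6 : (j * b + (b - 1 - m)) % b = b - 1 - m := by
    rw [Nat.mul_add_mod_self_right, Nat.mod_eq_of_lt (by omega)]
  rw [fieldBit, h3, h4, h5, h6, show b - 1 - (b - 1 - m) = m by omega]
  simp [hj]

/-! ### Recovering the field width from the first word of the memory -/

/-- The bit string that holds the array `G`; if the fields take a large part of a word, their
width is put into a word of its own that starts with a `1`. -/
def dataString (w b N : ℕ) (G : ℕ → ℕ) : List Bool :=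
  if 3 * b ≤ w then fieldString w b N G
  else bitList w (2 ^ (w - 1) + b) ++ fieldString w b N G

/-- The extra word is present only if `w < 3 * b`, and is paid for by the term for one more field.
-/
theorem length_dataString_le {w b N : ℕ} {G : ℕ → ℕ} (hb : 1 ≤ b) (hbw : b ≤ w) :
    (dataString w b N G).length ≤ 3 * (N + 1) * b := by
  have := length_fieldString_le (N := N) (G := G) hb hbw
  rw [dataString]
  split_ifs with h
  · exact this.trans (by nlinarith)
  · rw [List.length_append, length_bitList]
    nlinarith

/-- The conditions on an array with a header from which its field width is found. -/
structure IsFieldArray (w b N : ℕ) (G : ℕ → ℕ) : Prop where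
  three_le : 3 ≤ b
  le_wordSize : b ≤ w
  size_le : N + 3 ≤ 2 ^ b
  field_lt : ∀ j, G j < 2 ^ b
  eq_zero : ∀ j, N ≤ j → G j = 0
  field_zero : G 0 = 1
  field_one : G 1 = 0
  field_two : G 2 = b

namespace Expr

/-- The first word of the memory. -/
def firstWord : Expr := .load (.const 0)

/-- The number `2 ^ (w - 1)`. -/
def halfRange : Expr := .op .shl (.const 1) (.op .sub .wordSize (.const 1))

/-- The number `2 ^ w - 1`. -/
def allOnes : Expr := .op .add (.op .sub halfRange (.const 1)) halfRange

/-- The number `2 ^ b`, where `b` is the field width, if it is small. -/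
def fieldRange : Expr := .op .add (.op .div allOnes firstWord) (.const 1)

/-- The field width. -/
def fieldWidth : Expr :=
  -- The leading bit tells the two layouts apart. If it is zero, two multiplications by `2^b` shift
  -- out the fields `1` and `0`, and division by `2^(w-b)` leaves the next field, which is `b`.
  .iteLt firstWord halfRange
    (.op .div (.op .mul (.op .mul firstWord fieldRange) fieldRange)
      (.op .add (.op .div allOnes fieldRange) (.const 1)))
    (.op .sub firstWord halfRange)

/-- The number of fields in a word. -/
def fieldsPerWord : Expr := .op .div .wordSize fieldWidth

/-- The position of the first field of the array. -/
def fieldStart : Expr := .iteLt firstWord halfRange (.const 0) fieldsPerWord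

/-- The field number `x` of the array. -/
def field (x : Expr) : Expr :=
  .op .shr
    (.op .shl (.load (.op .div (.op .add fieldStart x) fieldsPerWord))
      (.op .mul (.op .mod (.op .add fieldStart x) fieldsPerWord) fieldWidth))
    (.op .sub .wordSize fieldWidth)

end Expr

open PrefixCodeRAM.Expr

section Field

variable {w b N : ℕ} {G : ℕ → ℕ} {r : Regs w}

theorem toNat_memory {B : List Bool} {q : ℕ} (hq : q < 2 ^ w) :
    (memory w B (BitVec.ofNat w q)).toNat = (packWord w (padded B) q).toNat := by
  rw [memory, BitVec.toNat_ofNat, Nat.mod_eq_of_lt hq]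

theorem val_halfRange {mem : BitVec w → BitVec w} (hw : 1 ≤ w) :
    Val mem r halfRange (2 ^ (w - 1)) := by
  have h1 : 1 < 2 ^ w := Nat.one_lt_two_pow (by omega)
  refine ((val_const h1).shl (val_wordSize.sub (val_const h1) hw)).congr ?_
  rw [one_mul, Nat.mod_eq_of_lt (Nat.pow_lt_pow_right (by norm_num) (by omega))]

theorem val_allOnes {mem : BitVec w → BitVec w} (hw : 1 ≤ w) :
    Val mem r allOnes (2 ^ w - 1) := by
  have h1 : 1 < 2 ^ w := Nat.one_lt_two_pow (by omega)
  have h2 : 2 ^ w = 2 ^ (w - 1) + 2 ^ (w - 1) := by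
    rw [← mul_two, ← pow_succ, Nat.sub_add_cancel hw]
  have h3 : 1 ≤ 2 ^ (w - 1) := Nat.one_le_two_pow
  exact (((val_halfRange hw).sub (val_const h1) h3).add (val_halfRange hw) (by omega)).congr
    (by omega)

/-- The first word is the first word of the fields. -/
theorem IsFieldArray.firstWord_small (h : IsFieldArray w b N G) (hw : 3 * b ≤ w) :
    ∃ δ, Val (memory w (dataString w b N G)) r firstWord (2 ^ (w - b) + δ) ∧
      δ * 2 ^ b < 2 ^ (w - b) ∧
      (2 ^ (w - b) + δ) * 2 ^ (2 * b) % 2 ^ w / 2 ^ (w - b) = b := by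
  have hb := h.three_le
  have hpos : 0 < 2 ^ w := by positivity
  have hv : Val (memory w (dataString w b N G)) r firstWord
      (packWord w (fieldBit w b G) 0).toNat := by
    refine ((val_const hpos).load).congr ?_
    rw [toNat_memory hpos, dataString, if_pos hw,
      padded_fieldString (by omega) h.le_wordSize h.eq_zero]
  have hf : 3 ≤ w / b := (Nat.le_div_iff_mul_le (by omega)).2 hw
  have hread : ∀ j < 3, (packWord w (fieldBit w b G) 0).toNat * 2 ^ (j * b) % 2 ^ w
      / 2 ^ (w - b) = G j := fun j hj => by
    have h1 : (j + 1) * b ≤ 3 * b := Nat.mul_le_mul_right _ hj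
    rw [shift_packWord _ _ (by rw [Nat.add_mul] at h1; omega),
      readBits_fieldBit h.field_lt 0 (by omega)]
    simp
  set V := (packWord w (fieldBit w b G) 0).toNat with hV
  have hlt : V < 2 ^ w := BitVec.isLt _
  have h0 := hread 0 (by norm_num)
  have h1 := hread 1 (by norm_num)
  have h2 := hread 2 (by norm_num)
  rw [zero_mul, pow_zero, mul_one, Nat.mod_eq_of_lt hlt, h.field_zero] at h0
  rw [one_mul, h.field_one] at h1
  rw [h.field_two] at h2
  have hdm := Nat.div_add_mod V (2 ^ (w - b))
  rw [h0, mul_one] at hdm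
  have hmul : 2 ^ (w - b) * 2 ^ b = 2 ^ w := by rw [← pow_add, Nat.sub_add_cancel h.le_wordSize]
  refine ⟨V % 2 ^ (w - b), by rwa [hdm], ?_, by rwa [hdm]⟩
  have h3 : V % 2 ^ (w - b) < 2 ^ (w - b) := Nat.mod_lt _ (by positivity)
  -- That field `1` vanishes is exactly the bound on the part of the word below field `0`.
  have h4 := (Nat.div_eq_zero_iff.1 h1).resolve_left (by positivity)
  rw [← hdm, Nat.add_mul, hmul, Nat.add_mod_left, Nat.mod_eq_of_lt] at h4
  · exact h4
  · rw [← hmul]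
    exact Nat.mul_lt_mul_of_pos_right h3 (by positivity)

theorem IsFieldArray.packWord_succ (hw : ¬ 3 * b ≤ w) (q : ℕ) :
    packWord w (padded (dataString w b N G)) (q + 1)
      = packWord w (padded (fieldString w b N G)) q := by
  rw [packWord, packWord]
  congr 1
  funext i
  rw [dataString, if_neg hw, show (q + 1) * w + (i : ℕ)
    = (bitList w (2 ^ (w - 1) + b)).length + (q * w + i) by rw [length_bitList]; ring,
    padded_append_right]

theorem IsFieldArray.firstWord_large (h : IsFieldArray w b N G) (hw : ¬ 3 * b ≤ w) :
    Val (memory w (dataString w b N G)) r firstWord (2 ^ (w - 1) + b) := by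
  have hb := h.three_le
  have hbw := h.le_wordSize
  have hpos : 0 < 2 ^ w := by positivity
  refine ((val_const hpos).load).congr ?_
  rw [toNat_memory hpos, packWord_eq_readBits]
  symm
  have h1 : w < 2 ^ (w - 1) := by
    obtain ⟨k, rfl⟩ : ∃ k, w = k + 3 := ⟨w - 3, by omega⟩
    have : k < 2 ^ k := Nat.lt_two_pow_self
    rw [show k + 3 - 1 = k + 2 by omega, pow_add]
    omega
  have h2 : 2 ^ w = 2 ^ (w - 1) + 2 ^ (w - 1) := by
    rw [← mul_two, ← pow_succ, Nat.sub_add_cancel (by omega)]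
  refine eq_readBits (by omega) fun m hm => ?_
  rw [dataString, if_neg hw, zero_mul, zero_add, padded_append_left (by simp; omega),
    padded_bitList (by omega)]
  congr 1
  omega

/-- As `b ≥ 3`, the field `1` at the front leaves the leading bit zero, whereas the separate width
word sets it. In both layouts the word is nonzero, which distinguishes the array from empty memory.
-/
theorem IsFieldArray.val_firstWord (h : IsFieldArray w b N G) :
    ∃ V, V ≠ 0 ∧ Val (memory w (dataString w b N G)) r firstWord V ∧
      (V < 2 ^ (w - 1) ↔ 3 * b ≤ w) := by
  have hb := h.three_le
  by_cases hw : 3 * b ≤ w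
  · obtain ⟨δ, h1, h2, -⟩ := h.firstWord_small (r := r) hw
    refine ⟨_, ?_, h1, iff_of_true ?_ hw⟩
    · have : 0 < 2 ^ (w - b) := by positivity
      omega
    · have h3 : δ ≤ δ * 2 ^ b := Nat.le_mul_of_pos_right _ (by positivity)
      have h4 : 2 ^ (w - b + 1) ≤ 2 ^ (w - 1) := Nat.pow_le_pow_right (by norm_num) (by omega)
      rw [pow_succ] at h4
      omega
  · exact ⟨_, by positivity, h.firstWord_large hw, iff_of_false (by omega) hw⟩

theorem IsFieldArray.val_fieldWidth (h : IsFieldArray w b N G) :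
    Val (memory w (dataString w b N G)) r fieldWidth b := by
  have hb := h.three_le
  have hbw := h.le_wordSize
  obtain ⟨V, hV0, hV, hV'⟩ := h.val_firstWord (r := r)
  have hhalf : Val (memory w (dataString w b N G)) r halfRange (2 ^ (w - 1)) :=
    val_halfRange (by omega)
  by_cases hw : 3 * b ≤ w
  · rw [Val, fieldWidth, hV.iteLt_lt hhalf (hV'.2 hw)]
    obtain ⟨δ, h1, h2, h3⟩ := h.firstWord_small (r := r) hw
    have hmul : 2 ^ (w - b) * 2 ^ b = 2 ^ w := by rw [← pow_add, Nat.sub_add_cancel hbw]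
    have hone : 1 < 2 ^ w := Nat.one_lt_two_pow (by omega)
    have hY : 1 ≤ 2 ^ b := Nat.one_le_two_pow
    have hX : 1 ≤ 2 ^ (w - b) := Nat.one_le_two_pow
    -- With `X = 2^(w-b)` and `Y = 2^b`, the inequality `δ * Y < X` gives `(Y-1) * (X+δ) < X*Y`,
    -- while `Y * (X+δ) ≥ X*Y`. The number `X*Y = 2^w` is not a word, hence the division of `2^w -
    -- 1`.
    have hdiv : (2 ^ w - 1) / (2 ^ (w - b) + δ) = 2 ^ b - 1 := by
      rw [← hmul]
      generalize 2 ^ (w - b) = X at *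
      generalize 2 ^ b = Y at *
      obtain ⟨y, rfl⟩ : ∃ y, Y = y + 1 := ⟨Y - 1, by omega⟩
      rw [Nat.add_sub_cancel]
      refine Nat.div_eq_of_lt_le ?_ ?_
      · have : y * (X + δ) + 1 ≤ X * (y + 1) := by nlinarith
        omega
      · have : X * (y + 1) ≤ (y + 1) * (X + δ) := by nlinarith
        have : 0 < X * (y + 1) := by positivity
        omega
    have hrange : Val (memory w (dataString w b N G)) r fieldRange (2 ^ b) := by
      have hYw : 2 ^ b < 2 ^ w := Nat.pow_lt_pow_right (by norm_num) (by omega)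
      refine (((val_allOnes (by omega)).div h1).add (val_const hone) ?_).congr ?_
      · rw [hdiv]; omega
      · rw [hdiv]; omega
    have htop : Val (memory w (dataString w b N G)) r
        (.op .add (.op .div allOnes fieldRange) (.const 1)) (2 ^ (w - b)) := by
      have : (2 ^ w - 1) / 2 ^ b = 2 ^ (w - b) - 1 := by
        rw [← hmul]
        generalize 2 ^ (w - b) = X at *
        generalize 2 ^ b = Y at *
        obtain ⟨x, rfl⟩ : ∃ x, X = x + 1 := ⟨X - 1, by omega⟩
        rw [Nat.add_sub_cancel]
        refine Nat.div_eq_of_lt_le ?_ ?_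
        · rw [Nat.add_mul]; omega
        · have : 0 < (x + 1) * Y := by positivity
          omega
      have hXw : 2 ^ (w - b) < 2 ^ w := Nat.pow_lt_pow_right (by norm_num) (by omega)
      refine (((val_allOnes (by omega)).div hrange).add (val_const hone) ?_).congr ?_
      · rw [this]; omega
      · rw [this]; omega
    refine (((h1.mulMod hrange).mulMod hrange).div htop).congr ?_
    rw [Nat.mod_mul_mod, mul_assoc, ← pow_add, ← two_mul]
    exact h3
  · rw [Val, fieldWidth, hV.iteLt_le hhalf (not_lt.1 (mt hV'.1 hw))]
    exact ((h.firstWord_large hw).sub hhalf (by omega)).congr (by omega)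

/-- Reading a field of the array. -/
theorem IsFieldArray.val_field (h : IsFieldArray w b N G) {x : Expr} {j : ℕ} (hj : j < N)
    (hx : Val (memory w (dataString w b N G)) r x j) :
    Val (memory w (dataString w b N G)) r (field x) (G j) := by
  have hb := h.three_le
  have hbw := h.le_wordSize
  have hN := h.size_le
  have hpow : 2 ^ b ≤ 2 ^ w := Nat.pow_le_pow_right (by norm_num) hbw
  have hf : 1 ≤ w / b := (Nat.one_le_div_iff (by omega)).2 hbw
  obtain ⟨V, hV0, hV, hV'⟩ := h.val_firstWord (r := r)
  have hhalf : Val (memory w (dataString w b N G)) r halfRange (2 ^ (w - 1)) :=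
    val_halfRange (by omega)
  have hper : Val (memory w (dataString w b N G)) r fieldsPerWord (w / b) :=
    val_wordSize.div h.val_fieldWidth
  have hmul : w / b * b ≤ w := Nat.div_mul_le_self _ _
  have hlast : ∀ i, i < w / b → i * b + b ≤ w := fun i hi => by
    have : (i + 1) * b ≤ w / b * b := Nat.mul_le_mul_right _ hi
    rw [Nat.add_mul] at this
    omega
  -- Here `a` is the number of field slots before the array: `0`, or the `w / b` slots of the
  -- separate width word.
  suffices hmain : ∃ a q, Val (memory w (dataString w b N G)) r fieldStart a ∧ a + j < 2 ^ w ∧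
      packWord w (padded (dataString w b N G)) ((a + j) / (w / b))
        = packWord w (fieldBit w b G) q ∧ q * (w / b) + (a + j) % (w / b) = j by
    obtain ⟨a, q, ha, haj, hword, hq⟩ := hmain
    have hidx := ha.add hx haj
    have hmod := Nat.mod_lt (a + j) hf
    have hoff := hlast _ hmod
    have hww : w < 2 ^ w := Nat.lt_two_pow_self
    refine (((hidx.div hper).load.shl ((hidx.mod hper).mul h.val_fieldWidth (by omega))).shr
      (val_wordSize.sub h.val_fieldWidth hbw)).congr ?_
    rw [toNat_memory ((Nat.div_le_self _ _).trans_lt haj), hword, shift_packWord _ _ hoff,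
      readBits_fieldBit h.field_lt _ hmod, hq]
  by_cases hw : 3 * b ≤ w
  · refine ⟨0, j / (w / b), ?_, by omega, ?_, ?_⟩
    · rw [Val, fieldStart, hV.iteLt_lt hhalf (hV'.2 hw)]
      exact val_const (by positivity)
    · rw [zero_add, dataString, if_pos hw, padded_fieldString (by omega) hbw h.eq_zero]
    · rw [zero_add, mul_comm, Nat.div_add_mod]
  -- At most two slots are skipped, so `size_le` keeps the shifted index below `2 ^ w`.
  · have hf3 : w / b < 3 := (Nat.div_lt_iff_lt_mul (by omega)).2 (by omega)
    refine ⟨w / b, j / (w / b), ?_, by omega, ?_, ?_⟩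
    · rw [Val, fieldStart, hV.iteLt_le hhalf (not_lt.1 (mt hV'.1 hw))]
      exact hper
    · rw [Nat.add_div_left _ hf, IsFieldArray.packWord_succ hw,
        padded_fieldString (by omega) hbw h.eq_zero]
    · rw [Nat.add_mod_left, mul_comm, Nat.div_add_mod]

end Field

/-! ### Specifications in terms of expressions -/

/-- The registers at the start of the encoding of the symbol `i`. -/
def encInit (w i : ℕ) : Regs w := fun j => if j = 0 then BitVec.ofNat w i else 0

/-- The registers at the start of the decoding of the stream `s`. -/
def decInit (w k : ℕ) (s : ℕ → Bool) : Regs w := fun j => if j < k then packWord w s j else 0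

/-- The expressions `E 0, …, E k` compute the output of the encoder. -/
def EncodesBy {n : ℕ} (w : ℕ) (B : List Bool) (code : Fin n → List Bool) (k : ℕ)
    (E : ℕ → Expr) : Prop :=
  ∀ i : Fin n, (code i).length ≤ k * w ∧
    ((E 0).eval (memory w B) (encInit w i)).toNat = (code i).length ∧
    ∀ j < k, (E (j + 1)).eval (memory w B) (encInit w i) = packWord w (padded (code i)) j

/-- The expressions `E 0` and `E 1` compute the output of the decoder. -/
def DecodesBy {n : ℕ} (w : ℕ) (B : List Bool) (code : Fin n → List Bool) (k : ℕ)
    (E : ℕ → Expr) : Prop :=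
  ∀ (i : Fin n) (s : ℕ → Bool), StartsWith (code i) s →
    ((E 0).eval (memory w B) (decInit w k s)).toNat = (i : ℕ) ∧
    ((E 1).eval (memory w B) (decInit w k s)).toNat = (code i).length

/-! ### Small word sizes -/

/-- The memory that holds the length of the codeword of `i` at the address `i`. -/
def lengthTable {n : ℕ} (w : ℕ) (code : Fin n → List Bool) : BitVec w → BitVec w := fun a =>
  if h : a.toNat < n then BitVec.ofNat w (code ⟨a.toNat, h⟩).length else 0

/-- For `n = 1` the only length is zero, so the empty string already represents the table. This is
needed because `log₂ 1 = 0` leaves no space. -/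
theorem exists_memory_eq_lengthTable {n w : ℕ} {code : Fin n → List Bool} (hn : n ≤ 2 ^ w)
    (hlt : ∀ i, (code i).length < n) :
    ∃ B : List Bool, B.length ≤ 2 ^ w * w ∧ (n = 1 → B = []) ∧
      memory w B = lengthTable w code := by
  have hword : ∀ (B : List Bool) (a : BitVec w),
      (∀ m < w, padded B (a.toNat * w + (w - 1 - m)) = (lengthTable w code a).toNat.testBit m) →
      memory w B a = lengthTable w code a := fun B a h => by
    refine BitVec.eq_of_toNat_eq (Nat.eq_of_testBit_eq fun m => ?_)
    rw [memory, testBit_packWord]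
    by_cases hm : m < w
    · simp [hm, h m hm]
    · have : 2 ^ w ≤ 2 ^ m := Nat.pow_le_pow_right (by norm_num) (by omega)
      rw [Nat.testBit_lt_two_pow ((BitVec.isLt _).trans_le this)]
      simp [hm]
  by_cases h1 : n = 1
  · refine ⟨[], by simp, fun _ => rfl, funext fun a => hword _ _ fun m _ => ?_⟩
    have h0 : lengthTable w code a = 0 := by
      rw [lengthTable]
      split_ifs with h
      · have := hlt ⟨_, h⟩
        rw [show (code ⟨a.toNat, h⟩).length = 0 by omega]
        rfl
      · rfl
    rw [padded_of_length_le (by simp), h0]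
    simp
  · refine ⟨List.ofFn fun x : Fin (n * w) =>
      (lengthTable w code (BitVec.ofNat w (x / w))).toNat.testBit (w - 1 - x % w), ?_,
      fun h => absurd h h1, funext fun a => hword _ _ fun m hm => ?_⟩
    · simpa using Nat.mul_le_mul_right w hn
    · have h2 : (a.toNat * w + (w - 1 - m)) / w = a.toNat := by
        rw [mul_comm, Nat.mul_add_div (by omega), Nat.div_eq_of_lt (by omega), add_zero]
      have h3 : (a.toNat * w + (w - 1 - m)) % w = w - 1 - m := by
        rw [Nat.mul_add_mod_self_right, Nat.mod_eq_of_lt (by omega)]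
      by_cases ha : a.toNat < n
      · have hlt' : a.toNat * w + (w - 1 - m) < n * w := by
          have : (a.toNat + 1) * w ≤ n * w := Nat.mul_le_mul_right _ ha
          rw [Nat.add_mul] at this
          omega
        rw [padded_eq_getElem (by simpa using hlt'), List.getElem_ofFn]
        simp only [h2, h3, BitVec.ofNat_toNat, BitVec.setWidth_eq]
        rw [show w - 1 - (w - 1 - m) = m by omega]
      · have hle : n * w ≤ a.toNat * w := Nat.mul_le_mul_right _ (by omega)
        rw [padded_of_length_le (by simp; omega), lengthTable, dif_neg ha]
        simp

/-- The code belongs to a word size that is large enough, and its lengths fit into words. -/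
def FitsWord (w : ℕ) (c : Σ n, Fin n → List Bool) : Prop :=
  1 ≤ c.1 ∧ c.1 ≤ 2 ^ w ∧ IsPrefixCode c.2 ∧ ∀ i, (c.2 i).length < c.1

open Classical in
/-- A code with a given table of lengths. -/
noncomputable def codeOfTable {w : ℕ} (mem : BitVec w → BitVec w) : Σ n, Fin n → List Bool :=
  if h : ∃ c, FitsWord w c ∧ lengthTable w c.2 = mem then h.choose else ⟨0, fun _ => []⟩

/-- The table determines the number of symbols: if one code had fewer symbols than the other, its
entry at the address just past its last symbol would be zero, whereas the larger code has at least
two symbols and so only positive lengths. Equal lengths then suffice, since the average depends on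
nothing else. -/
theorem codeOfTable_lengthTable {n w : ℕ} {code : Fin n → List Bool} (h : FitsWord w ⟨n, code⟩) :
    ∃ code' : Fin n → List Bool, codeOfTable (lengthTable w code) = ⟨n, code'⟩ ∧
      IsPrefixCode code' ∧ ∀ i, (code' i).length = (code i).length := by
  have hex : ∃ c, FitsWord w c ∧ lengthTable w c.2 = lengthTable w code := ⟨_, h, rfl⟩
  obtain ⟨hf, he⟩ := hex.choose_spec
  have hco : codeOfTable (lengthTable w code) = hex.choose := dif_pos hex
  rw [hco]
  generalize hex.choose = c at hf he
  obtain ⟨n', code'⟩ := c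
  have key : ∀ {n₁ n₂ : ℕ} {c₁ : Fin n₁ → List Bool} {c₂ : Fin n₂ → List Bool},
      FitsWord w ⟨n₁, c₁⟩ → FitsWord w ⟨n₂, c₂⟩ → lengthTable w c₁ = lengthTable w c₂ →
      ¬ n₁ < n₂ := by
    intro n₁ n₂ c₁ c₂ h₁ h₂ hc hlt
    obtain ⟨h11, -, -, -⟩ := h₁
    obtain ⟨-, h22, h23, h24⟩ := h₂
    simp only at h11 h22 h23 h24
    have h3 := congrFun hc (BitVec.ofNat w n₁)
    have h4 : (BitVec.ofNat w n₁).toNat = n₁ := by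
      rw [BitVec.toNat_ofNat, Nat.mod_eq_of_lt (by omega)]
    rw [lengthTable, lengthTable, dif_neg (by omega), dif_pos (by omega)] at h3
    have h5 := congrArg BitVec.toNat h3
    have h6 := h24 ⟨(BitVec.ofNat w n₁).toNat, by omega⟩
    rw [BitVec.toNat_ofNat, Nat.mod_eq_of_lt (by omega)] at h5
    have h7 := h23.length_pos (by omega) ⟨(BitVec.ofNat w n₁).toNat, by omega⟩
    simp only [BitVec.toNat_zero, BitVec.ofNat_eq_ofNat] at h5
    omega
  obtain rfl : n' = n := by
    have := key hf h he
    have := key h hf he.symm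
    omega
  refine ⟨code', rfl, hf.2.2.1, fun i => ?_⟩
  have h1 := congrArg BitVec.toNat (congrFun he (BitVec.ofNat w i))
  have h2 := hf.2.1
  have h3 := hf.2.2.2 i
  have h4 := h.2.2.2 i
  have h5 := i.2
  simp only at h2 h3 h4
  have h6 : (BitVec.ofNat w i).toNat = i := by
    rw [BitVec.toNat_ofNat, Nat.mod_eq_of_lt (by omega)]
  simp only [lengthTable, h6, i.2, dif_pos, Fin.eta, BitVec.toNat_ofNat] at h1
  rwa [Nat.mod_eq_of_lt (by omega), Nat.mod_eq_of_lt (by omega)] at h1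

theorem eq_of_packWord_eq {w : ℕ} {s s' : ℕ → Bool} {k : ℕ}
    (h : ∀ j < k, packWord w s j = packWord w s' j) {x : ℕ} (hx : x < k * w) : s x = s' x := by
  have hw : 0 < w := Nat.pos_of_ne_zero fun h0 => by simp [h0] at hx
  have h1 := congrArg (fun v => v.toNat.testBit (w - 1 - x % w))
    (h (x / w) ((Nat.div_lt_iff_lt_mul hw).2 hx))
  have h2 := Nat.mod_lt x hw
  simp only [testBit_packWord, show w - 1 - x % w < w by omega, decide_true, Bool.true_and,
    show w - 1 - (w - 1 - x % w) = x % w by omega, Nat.div_add_mod'] at h1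
  exact h1

/-- The output `j` of the encoder for the symbol `i`. -/
def encOutput (w j : ℕ) (c : Σ n, Fin n → List Bool) (i : ℕ) : BitVec w :=
  if h : i < c.1 then
    if j = 0 then BitVec.ofNat w (c.2 ⟨i, h⟩).length
    else packWord w (padded (c.2 ⟨i, h⟩)) (j - 1)
  else 0

/-- At a fixed word size optimal codes are encoded and decoded by lookup. -/
theorem exists_expr_of_wordSize (w k : ℕ) (hk : 2 ^ w ≤ k) :
    ∃ E D : ℕ → Expr, ∀ n : ℕ, 1 ≤ n → n ≤ 2 ^ w → ∀ p : Fin n → ℝ, (∀ i, 0 ≤ p i) →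
      ∃ (code : Fin n → List Bool) (B : List Bool), IsPrefixCode code ∧
        avgLength p code = optAvgLength p ∧ B.length ≤ 2 ^ w * w ∧ (n = 1 → B = []) ∧
        EncodesBy w B code k E ∧ DecodesBy w B code k D := by
  classical
  -- Encoder and decoder both apply `codeOfTable` to the memory, and so they agree on the code
  -- although its bits are not stored.
  have hE : ∀ j, ∃ e : Expr, ∀ (mem : BitVec w → BitVec w) (r : Regs w),
      (∀ j, k ≤ j → r j = 0) → e.eval mem r =
        encOutput w j (codeOfTable mem) (r 0).toNat := fun j =>
      Expr.exists_eval_eq w k fun mem r => encOutput w j (codeOfTable mem) (r 0).toNat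
  have hD : ∀ j, ∃ e : Expr, ∀ (mem : BitVec w → BitVec w) (r : Regs w),
      (∀ j, k ≤ j → r j = 0) → e.eval mem r =
        if h : ∃ i, ∃ s, StartsWith ((codeOfTable mem).2 i) s ∧ ∀ j < k, r j = packWord w s j then
          if j = 0 then BitVec.ofNat w h.choose
          else BitVec.ofNat w ((codeOfTable mem).2 h.choose).length
        else 0 := fun j => Expr.exists_eval_eq w k fun mem r =>
          if h : ∃ i, ∃ s, StartsWith ((codeOfTable mem).2 i) s ∧ ∀ j < k, r j = packWord w s j then
            if j = 0 then BitVec.ofNat w h.choose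
            else BitVec.ofNat w ((codeOfTable mem).2 h.choose).length
          else 0
  choose E hE using hE
  choose D hD using hD
  refine ⟨E, D, fun n hn1 hn p hp => ?_⟩
  obtain ⟨code₀, hpre₀, hopt, hmin⟩ := exists_optimal_code p hp
  have hlt₀ := hpre₀.length_lt_of_minimal hmin
  obtain ⟨B, hB, hB1, hmem⟩ := exists_memory_eq_lengthTable hn hlt₀
  obtain ⟨code, hcode, hpre, hlen⟩ := codeOfTable_lengthTable (w := w) (code := code₀)
    ⟨hn1, hn, hpre₀, hlt₀⟩
  rw [← hmem] at hcode
  have hlt : ∀ i, (code i).length < n := fun i => hlen i ▸ hlt₀ i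
  have hk0 : 0 < k := lt_of_lt_of_le (by positivity) hk
  have hkw : ∀ i, (code i).length ≤ k * w := fun i => by
    have := hlt i
    rcases Nat.eq_zero_or_pos w with rfl | hw
    · simp at hn; omega
    · have : k ≤ k * w := Nat.le_mul_of_pos_right _ hw
      omega
  refine ⟨code, B, hpre, ?_, hB, hB1, fun i => ?_, fun i s hs => ?_⟩
  · rw [← hopt]; simp [avgLength, hlen]
  · have hr : ∀ j, k ≤ j → encInit w i j = 0 := fun j hj => if_neg (by omega)
    have h0 : (encInit w i 0).toNat = i := by
      simp [encInit, Nat.mod_eq_of_lt (i.2.trans_le hn)]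
    refine ⟨hkw i, ?_, fun j _ => ?_⟩
    · rw [hE 0 _ _ hr, hcode, h0]
      simp [encOutput, Nat.mod_eq_of_lt ((hlt i).trans_le hn)]
    · rw [hE (j + 1) _ _ hr, hcode, h0]
      simp [encOutput]
  · have hr : ∀ j, k ≤ j → decInit w k s j = 0 := fun j hj => if_neg (by omega)
    have hex : ∃ i, ∃ s', StartsWith ((codeOfTable (memory w B)).2 i) s' ∧
        ∀ j < k, decInit w k s j = packWord w s' j := by
      rw [hcode]
      exact ⟨i, s, hs, fun j hj => if_pos hj⟩
    have hchoose : (hex.choose : ℕ) = i ∧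
        ((codeOfTable (memory w B)).2 hex.choose).length = (code i).length := by
      obtain ⟨s', hs', hr'⟩ := hex.choose_spec
      generalize hex.choose = i' at hs'
      revert i'
      rw [hcode]
      intro i' hs'
      simp only at hs'
      have : i' = i := by
        refine hpre.eq_of_startsWith hs' fun j hj => ?_
        rw [← hs j hj]
        refine eq_of_packWord_eq (w := w) (k := k) (fun l hl => ?_) (hj.trans_le (hkw i))
        rw [← hr' l hl, decInit, if_pos hl]
      rw [this]
      exact ⟨rfl, rfl⟩
    constructor
    · rw [hD 0 _ _ hr, dif_pos hex, if_pos rfl, hchoose.1, BitVec.toNat_ofNat,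
        Nat.mod_eq_of_lt (i.2.trans_le hn)]
    · rw [hD 1 _ _ hr, dif_pos hex, if_neg one_ne_zero, hchoose.2, BitVec.toNat_ofNat,
        Nat.mod_eq_of_lt ((hlt i).trans_le hn)]

/-! ### Arithmetic of shifted words -/

/-- Shifting left by `w - b` pushes out the bits from position `b` on. This reduces the product
modulo `2^b` in arithmetic modulo `2^w`. -/
theorem shift_eq_msHash {w b s a x : ℕ} (hbw : b ≤ w) :
    a * x % 2 ^ w * 2 ^ (w - b) % 2 ^ w / 2 ^ (w - b + s) = msHash b s a x := by
  have hw : 2 ^ w = 2 ^ b * 2 ^ (w - b) := by rw [← pow_add, Nat.add_sub_cancel' hbw]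
  rw [pow_add, ← Nat.div_div_eq_div_mul, msHash]
  congr 1
  conv_lhs => rw [hw, Nat.mul_mod_mul_right, ← hw, Nat.mod_mod_of_dvd _ (pow_dvd_pow 2 hbw)]
  exact Nat.mul_div_cancel _ (by positivity)

/-- Cutting out a field that may extend over two words. -/
theorem shift_or_packWord {w r b : ℕ} (s : ℕ → Bool) (hr : r ≤ w) (hb : b ≤ w) :
    ((packWord w s 0).toNat * 2 ^ r % 2 ^ w ||| (packWord w s 1).toNat / 2 ^ (w - r))
      / 2 ^ (w - b) = readBits s r b := by
  refine eq_readBits ?_ fun m hm => ?_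
  · rw [Nat.div_lt_iff_lt_mul (by positivity), ← pow_add, Nat.add_sub_cancel' hb]
    exact Nat.or_lt_two_pow (Nat.mod_lt _ (by positivity))
      ((Nat.div_le_self _ _).trans_lt (BitVec.isLt _))
  · rw [Nat.testBit_div_two_pow, Nat.testBit_or, Nat.testBit_mod_two_pow,
      Nat.testBit_mul_two_pow, Nat.testBit_div_two_pow, testBit_packWord, testBit_packWord]
    by_cases h : r ≤ m + (w - b)
    · simp only [show m + (w - b) < w by omega, h, show m + (w - b) - r < w by omega,
        show ¬ (m + (w - b) + (w - r) < w) by omega, decide_true, decide_false, Bool.true_and,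
        Bool.false_and, Bool.or_false]
      congr 1
      omega
    · simp only [h, show m + (w - b) + (w - r) < w by omega, decide_true, decide_false,
        Bool.true_and, Bool.false_and, Bool.and_false, Bool.false_or]
      congr 1
      omega

theorem packWord_eq_of_testBit {w q a : ℕ} {s : ℕ → Bool} {v : BitVec w} (hv : v.toNat = a)
    (h : ∀ m < w, a.testBit m = s (q * w + (w - 1 - m))) : v = packWord w s q := by
  refine BitVec.eq_of_toNat_eq ?_
  rw [packWord_eq_readBits]
  exact eq_readBits (BitVec.isLt _) fun m hm => by rw [hv, h m hm]

theorem padded_append_bitList (e : List Bool) (b a x : ℕ) :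
    padded (e ++ bitList b a) x = if x < e.length then padded e x else
      (decide (x - e.length < b) && a.testBit (b - 1 - (x - e.length))) := by
  split_ifs with h
  · exact padded_append_left h
  · obtain ⟨y, rfl⟩ := Nat.exists_eq_add_of_le (not_lt.1 h)
    rw [padded_append_right, Nat.add_sub_cancel_left]
    by_cases hy : y < b
    · simp [padded_bitList hy, hy]
    · simp [padded_of_length_le (l := bitList b a) (j := y) (by simpa using hy), hy]

/-- A short codeword, moved to the front of a word. -/
theorem testBit_shortWord {w m y : ℕ} {l : List Bool} (hm : m ≤ w) (hl : l.length ≤ m)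
    (hy : y < w) :
    (readBits (padded l) 0 m * 2 ^ (w - m) % 2 ^ w).testBit y = padded l (w - 1 - y) := by
  rw [Nat.testBit_mod_two_pow, Nat.testBit_mul_two_pow, testBit_readBits]
  by_cases h : w - m ≤ y
  · simp only [hy, h, show y - (w - m) < m by omega, decide_true, Bool.true_and, zero_add]
    congr 1
    omega
  · simp [h, padded_of_length_le (l := l) (j := w - 1 - y) (by omega)]

/-- The first word of the escape codeword followed by a symbol. -/
theorem testBit_escapeFirstWord {w b a y : ℕ} {e : List Bool} (hb : b ≤ w) (he : e.length ≤ w)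
    (hy : y < w) :
    (readBits (padded e) 0 e.length * 2 ^ (w - e.length) % 2 ^ w |||
      a * 2 ^ (w - b) % 2 ^ w / 2 ^ e.length).testBit y
      = padded (e ++ bitList b a) (w - 1 - y) := by
  rw [Nat.testBit_or, Nat.testBit_mod_two_pow, Nat.testBit_mul_two_pow, testBit_readBits,
    Nat.testBit_div_two_pow, Nat.testBit_mod_two_pow, Nat.testBit_mul_two_pow,
    padded_append_bitList]
  by_cases h : w - 1 - y < e.length
  · simp only [hy, h, show w - e.length ≤ y by omega, show y - (w - e.length) < e.length by omega,
      show ¬ (y + e.length < w) by omega, decide_true, decide_false, Bool.true_and,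
      Bool.false_and, Bool.or_false, if_true, zero_add]
    congr 1
    omega
  · simp only [h, show ¬ (w - e.length ≤ y) by omega, show y + e.length < w by omega,
      decide_true, decide_false, Bool.true_and, Bool.false_and, Bool.and_false, Bool.false_or,
      if_false]
    by_cases h' : w - b ≤ y + e.length
    · simp only [h', show w - 1 - y - e.length < b by omega, decide_true, Bool.true_and]
      congr 1
      omega
    · simp [h', show ¬ (w - 1 - y - e.length < b) by omega]

/-- The second word of the escape codeword followed by a symbol. -/
theorem testBit_escapeSecondWord {w b a y : ℕ} {e : List Bool} (hb : b ≤ w) (he : e.length ≤ w)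
    (hy : y < w) :
    (a * 2 ^ (w - b) % 2 ^ w * 2 ^ (w - e.length) % 2 ^ w).testBit y
      = padded (e ++ bitList b a) (w + (w - 1 - y)) := by
  rw [Nat.testBit_mod_two_pow, Nat.testBit_mul_two_pow, Nat.testBit_mod_two_pow,
    Nat.testBit_mul_two_pow, padded_append_bitList, if_neg (by omega)]
  by_cases h : w - e.length ≤ y
  · simp only [hy, h, show y - (w - e.length) < w by omega, decide_true, Bool.true_and]
    by_cases h' : w - b ≤ y - (w - e.length)
    · simp only [h', show w + (w - 1 - y) - e.length < b by omega, decide_true, Bool.true_and]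
      congr 1
      omega
    · simp [h', show ¬ (w + (w - 1 - y) - e.length < b) by omega]
  · simp [h, show ¬ (w + (w - 1 - y) - e.length < b) by omega]

/-! ### The encoding and decoding expressions for large word sizes

The fields `3, 4, 5` of the array hold the number of bits on which the decoder branches, the
escape codeword and the multiplier of the first hash function; from field `8` on the array is a
table with eight columns. -/

namespace Expr

/-- The entry in column `c` and row `y` of the table. -/
def cell (c : ℕ) (y : Expr) : Expr := field (.op .add (.op .mul (.const 8) y) (.const (c + 8)))

/-- The number of bits on which the decoder branches. -/
def prefixWidth : Expr := field (.const 3)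

/-- The number of bits of a word that do not belong to a field. -/
def spareBits : Expr := .op .sub .wordSize fieldWidth

/-- The hash function with multiplier `a` and shift `s`. -/
def hash (a s x : Expr) : Expr :=
  .op .shr (.op .shl (.op .mul a x) spareBits) (.op .add spareBits s)

/-- The bucket of the symbol in register `0`. -/
def bucket : Expr := hash (field (.const 5)) (.op .sub fieldWidth prefixWidth) (.reg 0)

/-- The position of the symbol in register `0` in the dictionary. -/
def position : Expr :=
  .op .add (cell 4 bucket) (hash (cell 2 bucket) (cell 3 bucket) (.reg 0))

/-- Zero if the memory is empty, and the value of `e` otherwise. -/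
def unlessEmpty (e : Expr) : Expr := .iteEq firstWord (.const 0) (.const 0) e

/-- The choice between the values for symbols that are in the dictionary and for those that
are not. -/
def ifStored (x y : Expr) : Expr :=
  -- Length zero marks an unused row, since codewords are nonempty for `n ≥ 2`; without this test
  -- the default `0` in column `5` would look like symbol `0`. A used row is compared with the
  -- symbol, because symbols outside the dictionary are hashed to some row too.
  .iteEq (cell 7 position) (.const 0) y (.iteEq (cell 5 position) (.reg 0) x y)

/-- The outputs of the encoder, with an escape codeword of length `l`. -/
def encoder (l : ℕ) : ℕ → Expr
  | 0 => unlessEmpty (ifStored (cell 7 position) (.op .add (.const l) fieldWidth))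
  | 1 => unlessEmpty (ifStored
      (.op .shl (cell 6 position) (.op .sub .wordSize prefixWidth))
      (.op .or (.op .shl (field (.const 4)) (.op .sub .wordSize (.const l)))
        (.op .shr (.op .shl (.reg 0) spareBits) (.const l))))
  | 2 => unlessEmpty (ifStored (.const 0)
      (.op .shl (.op .shl (.reg 0) spareBits) (.op .sub .wordSize (.const l))))
  | _ => .const 0

/-- The first bits of the stream. -/
def streamPrefix : Expr := .op .shr (.reg 0) (.op .sub .wordSize prefixWidth)

/-- The outputs of the decoder, with an escape codeword of length `l`. -/
def decoder (l : ℕ) : ℕ → Expr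
  | 0 => unlessEmpty (.iteEq (cell 1 streamPrefix) (.const 0)
      -- No kept codeword begins the stream, so it begins with the escape word. The symbol after it
      -- may extend over two words.
      (.op .shr (.op .or (.op .shl (.reg 0) (.const l))
        (.op .shr (.reg 1) (.op .sub .wordSize (.const l)))) spareBits)
      (cell 0 streamPrefix))
  | _ => unlessEmpty (.iteEq (cell 1 streamPrefix) (.const 0)
      (.op .add (.const l) fieldWidth) (cell 1 streamPrefix))

end Expr

/-! ### Layout and correctness of the table -/

/-- The array with the given header, columns and number `R` of rows. -/
def tableArray (R : ℕ) (header : ℕ → ℕ) (col : ℕ → ℕ → ℕ) (j : ℕ) : ℕ :=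
  if j < 8 then header j else if j / 8 - 1 < R then col (j % 8) (j / 8 - 1) else 0

theorem tableArray_cell {R : ℕ} {header : ℕ → ℕ} {col : ℕ → ℕ → ℕ} {c y : ℕ} (hc : c < 8)
    (hy : y < R) : tableArray R header col (8 * y + (c + 8)) = col c y := by
  rw [tableArray, if_neg (by omega), show (8 * y + (c + 8)) / 8 - 1 = y by omega, if_pos hy,
    show (8 * y + (c + 8)) % 8 = c by omega]

/-- A partial function that finds a witness wherever there is one. -/
theorem exists_search {α : Type*} (P : ℕ → α → Prop) : ∃ f : ℕ → Option α,
    (∀ x i, f x = some i → P x i) ∧ ∀ x, f x = none → ∀ i, ¬ P x i := by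
  classical
  refine ⟨fun x => if h : ∃ i, P x i then some h.choose else none, fun x i h => ?_, fun x h => ?_⟩
  · simp only at h
    split_ifs at h with hx
    rw [← Option.some.inj h]
    exact hx.choose_spec
  · simp only at h
    split_ifs at h with hx
    exact not_exists.1 hx

/-- The columns of the table: symbols and lengths for the decoder, the second level of the hash
functions, and the dictionary with symbols, codewords and lengths for the encoder. -/
def tableColumn {n : ℕ} (code : Fin n → List Bool) (m : ℕ) (A s o : ℕ → ℕ)
    (f g : ℕ → Option (Fin n)) (c y : ℕ) : ℕ :=
  match c with
  | 0 => (f y).elim 0 fun i => i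
  | 1 => (f y).elim 0 fun i => (code i).length
  | 2 => A y
  | 3 => s y
  | 4 => o y
  | 5 => (g y).elim 0 fun i => i
  | 6 => (g y).elim 0 fun i => readBits (padded (code i)) 0 m
  | _ => (g y).elim 0 fun i => (code i).length

/-- The header of the array. -/
def tableHeader (b m e a : ℕ) (j : ℕ) : ℕ :=
  match j with
  | 0 => 1
  | 1 => 0
  | 2 => b
  | 3 => m
  | 4 => e
  | 5 => a
  | _ => 0

/-- A code with an escape codeword is stored in a table of `2 ^ (m + 4)` rows, where `m` bounds
the length of the codewords that do not use the escape codeword. -/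
theorem exists_table {n w b m k : ℕ} {code : Fin n → List Bool} {S : Finset (Fin n)}
    {e : List Bool} (hc : IsPrefixCode code) (hn : 2 ≤ n) (hb : n ≤ 2 ^ b) (hbw : b ≤ w)
    (hm : m + 8 ≤ b) (he : e.length ≤ b) (hk : 2 ≤ k) (hS : ∀ i ∈ S, (code i).length ≤ m)
    (hS' : ∀ i ∉ S, code i = e ++ bitList b i) :
    ∃ B : List Bool, B.length ≤ 3 * (8 * (2 ^ (m + 4) + 1) + 1) * b ∧
      EncodesBy w B code k (encoder e.length) ∧ DecodesBy w B code k (decoder e.length) := by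
  have hpos := hc.length_pos hn
  have hbb : b < 2 ^ b := Nat.lt_two_pow_self
  have hww : w < 2 ^ w := Nat.lt_two_pow_self
  have hpow : 2 ^ b ≤ 2 ^ w := Nat.pow_le_pow_right (by norm_num) hbw
  obtain ⟨a, A, s, o, ha, hA, hs, hinj, hlt⟩ := exists_perfectHash (b := b) (m := m) (by omega)
    (S.map Fin.valEmbedding) (fun x hx => by
      obtain ⟨i, -, rfl⟩ := Finset.mem_map.1 hx
      exact i.2.trans_le hb) (by rw [Finset.card_map]; exact hc.card_le S hS)
  set h : ℕ → ℕ := msHash b (b - m) a with hh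
  set pos : ℕ → ℕ := fun x => o (h x) + msHash b (s (h x)) (A (h x)) x with hposdef
  have hposlt : ∀ x, pos x < 2 ^ (m + 4) := hlt
  have hposinj : ∀ i ∈ S, ∀ j ∈ S, pos i = pos j → i = j := fun i hi j hj hij => by
    have := hinj (Finset.mem_coe.2 (Finset.mem_map_of_mem Fin.valEmbedding hi))
      (Finset.mem_coe.2 (Finset.mem_map_of_mem Fin.valEmbedding hj)) hij
    exact Fin.ext this
  have hhlt : ∀ x, h x < 2 ^ m := fun x => by
    simpa [Nat.sub_sub_self (show m ≤ b by omega)] using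
      msHash_lt (b := b) (s := b - m) (a := a) (x := x) (by omega)
  have hpm : 2 ^ m ≤ 2 ^ (m + 4) := Nat.pow_le_pow_right (by norm_num) (by omega)
  have hp4 : 0 < 2 ^ (m + 4) := by positivity
  have hpm4 : 2 ^ (m + 4) ≤ 2 ^ b := Nat.pow_le_pow_right (by norm_num) (by omega)
  -- `f` finds the kept symbol whose codeword begins the `m`-bit string `x`; `g` below inverts the
  -- perfect hash function.
  obtain ⟨f, hf, hf'⟩ := exists_search fun (x : ℕ) (i : Fin n) =>
    i ∈ S ∧ StartsWith (code i) fun j => x.testBit (m - 1 - j)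
  obtain ⟨g, hg, hg'⟩ := exists_search fun (x : ℕ) (i : Fin n) => i ∈ S ∧ pos i = x
  -- The offsets are bounded only at values that the first hash function takes. Reduction modulo
  -- `2^b` makes all of them fit into fields and changes none that is used.
  set col := tableColumn code m A s (fun y => o y % 2 ^ b) f g with hcol
  set ev := readBits (padded e) 0 e.length with hev
  set N := 8 * (2 ^ (m + 4) + 1) with hN
  set G := tableArray (2 ^ (m + 4)) (tableHeader b m ev a) col with hG
  have hlenS : ∀ i ∈ S, (code i).length < 2 ^ b := fun i hi => by
    have := hS i hi
    omega
  have hcol_lt : ∀ c y, col c y < 2 ^ b := by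
    intro c y
    have hp : 0 < 2 ^ b := by positivity
    have hfi : ∀ F : Fin n → ℕ, (∀ i ∈ S, F i < 2 ^ b) → (f y).elim 0 F < 2 ^ b := by
      intro F hF
      rcases hfy : f y with _ | i
      · exact hp
      · exact hF i (hf y i hfy).1
    have hgi : ∀ F : Fin n → ℕ, (∀ i ∈ S, F i < 2 ^ b) → (g y).elim 0 F < 2 ^ b := by
      intro F hF
      rcases hgy : g y with _ | i
      · exact hp
      · exact hF i (hg y i hgy).1
    simp only [hcol, tableColumn]
    split
    · exact hfi _ fun i _ => i.2.trans_le hb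
    · exact hfi _ hlenS
    · exact hA y
    · exact (hs y).trans_lt hbb
    · exact Nat.mod_lt _ hp
    · exact hgi _ fun i _ => i.2.trans_le hb
    · exact hgi _ fun i _ => (readBits_lt _ _ _).trans_le
        (Nat.pow_le_pow_right (by norm_num) (by omega))
    · exact hgi _ hlenS
  have hevlt : ev < 2 ^ b := (readBits_lt _ _ _).trans_le (Nat.pow_le_pow_right (by norm_num) he)
  have harr : IsFieldArray w b N G := by
    refine ⟨by omega, hbw, ?_, fun j => ?_, fun j hj => ?_, ?_, ?_, ?_⟩
    -- `N + 3 = 2^(m+7) + 11 ≤ 2^(m+8) ≤ 2^b`.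
    · have h1 : 2 ^ (m + 8) ≤ 2 ^ b := Nat.pow_le_pow_right (by norm_num) hm
      have h2 : 1 ≤ 2 ^ m := Nat.one_le_two_pow
      rw [hN]
      rw [pow_add] at h1 ⊢
      omega
    · simp only [hG, tableArray]
      split_ifs
      · simp only [tableHeader]
        split <;> omega
      · exact hcol_lt _ _
      · positivity
    · simp only [hG, tableArray]
      rw [if_neg (by omega), if_neg (by omega)]
    all_goals simp [hG, tableArray, tableHeader]
  refine ⟨dataString w b N G, length_dataString_le (by omega) hbw, ?_⟩
  have hsmall : ∀ {c : ℕ}, c < 16 → c < 2 ^ w := fun {c} hc16 => by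
    have : 2 ^ 8 ≤ 2 ^ w := Nat.pow_le_pow_right (by norm_num) (by omega)
    omega
  have hNle := harr.size_le
  set mem := memory w (dataString w b N G) with hmem
  have hcell : ∀ {r : Regs w} {c y : ℕ} {Y : Expr}, c < 8 → y < 2 ^ (m + 4) →
      Val mem r Y y → Val mem r (cell c Y) (col c y) := by
    intro r c y Y hc8 hy hY
    rw [← tableArray_cell (header := tableHeader b m ev a) (col := col) hc8 hy]
    exact harr.val_field (by omega) (((val_const (hsmall (by norm_num))).mul hY (by omega)).add
      (val_const (hsmall (by omega))) (by omega))
  have hheader : ∀ {r : Regs w} {j : ℕ}, j < 8 →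
      Val mem r (field (.const j)) (tableHeader b m ev a j) := by
    intro r j hj
    have : tableHeader b m ev a j = G j := by simp [hG, tableArray, hj]
    rw [this]
    exact harr.val_field (by omega) (val_const (hsmall (by omega)))
  have hwidth : ∀ {r : Regs w}, Val mem r fieldWidth b := fun {r} => harr.val_fieldWidth
  have hprefix : ∀ {r : Regs w}, Val mem r prefixWidth m := fun {r} => hheader (by norm_num)
  have hspare : ∀ {r : Regs w}, Val mem r spareBits (w - b) := fun {r} =>
    val_wordSize.sub hwidth hbw
  have hel : ∀ {r : Regs w}, Val mem r (.const e.length) e.length := fun {r} =>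
    val_const (by omega)
  have hunless : ∀ {r : Regs w} (x : Expr), (unlessEmpty x).eval mem r = x.eval mem r := by
    intro r x
    obtain ⟨V, hV0, hV, -⟩ := harr.val_firstWord (r := r)
    exact hV.iteEq_ne (val_const (by positivity)) hV0
  have hesc : ∀ {r : Regs w}, Val mem r (.op .add (.const e.length) fieldWidth)
      (e.length + b) := fun {r} => hel.add hwidth (by
    obtain ⟨d, rfl⟩ : ∃ d, b = d + 3 := ⟨b - 3, by omega⟩
    have : d < 2 ^ d := Nat.lt_two_pow_self
    rw [pow_add 2 d] at hpow
    omega)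
  have hlenEsc : ∀ i ∉ S, (code i).length = e.length + b := fun i hi => by simp [hS' i hi]
  constructor
  · intro i
    have hsym : Val mem (encInit w i) (.reg 0) i := by
      have : (i : ℕ) < 2 ^ w := by omega
      simp [Val, eval, encInit, Nat.mod_eq_of_lt this]
    have hhash : ∀ {X T : Expr} {x t : ℕ}, t ≤ b → Val mem (encInit w i) X x →
        Val mem (encInit w i) T t → Val mem (encInit w i) (hash X T (.reg 0)) (msHash b t x i) := by
      intro X T x t ht hX hT
      refine ((((hX.mulMod hsym).shl hspare).shr (hspare.add hT (by omega)))).congr ?_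
      exact shift_eq_msHash hbw
    have hbucket : Val mem (encInit w i) bucket (h i) :=
      hhash (Nat.sub_le _ _) (hheader (by norm_num)) (hwidth.sub hprefix (by omega))
    have hh4 : h i < 2 ^ (m + 4) := (hhlt i).trans_le hpm
    have hposv : Val mem (encInit w i) position (pos i) := by
      have h1 := hposlt i
      have h2 : col 4 (h i) = o (h i) := Nat.mod_eq_of_lt (by
        simp only [hposdef] at h1
        omega)
      refine ((hcell (by norm_num) hh4 hbucket).add (hhash (hs _) (hcell (by norm_num) hh4 hbucket)
        (hcell (by norm_num) hh4 hbucket)) ?_).congr ?_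
      · rw [h2]
        exact h1.trans_le (hpm4.trans hpow)
      · rw [h2]
        rfl
    have hcellpos : ∀ {c : ℕ}, c < 8 → Val mem (encInit w i) (cell c position) (col c (pos i)) :=
      fun {c} hc8 => hcell hc8 (hposlt i) hposv
    have hzero : Val mem (encInit w i) (.const 0) 0 := val_const (by positivity)
    by_cases hi : i ∈ S
    · have hgi : g (pos i) = some i := by
        rcases hgy : g (pos i) with _ | j
        · exact absurd ⟨hi, rfl⟩ (hg' _ hgy i)
        · obtain ⟨hj, hj'⟩ := hg _ _ hgy
          rw [hposinj j hj i hi hj']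
      have h5 : col 5 (pos i) = i := by simp [hcol, tableColumn, hgi]
      have h6 : col 6 (pos i) = readBits (padded (code i)) 0 m := by
        simp [hcol, tableColumn, hgi]
      have h7 : col 7 (pos i) = (code i).length := by simp [hcol, tableColumn, hgi]
      have hst : ∀ x y : Expr, (ifStored x y).eval mem (encInit w i) = x.eval mem (encInit w i) :=
        fun x y => by
          have h1 := hpos i
          rw [ifStored, (hcellpos (by norm_num)).iteEq_ne hzero (by omega),
            (hcellpos (by norm_num)).iteEq_eq hsym h5]
      have hli := hS i hi
      have hkw : w ≤ k * w := Nat.le_mul_of_pos_left _ (by omega)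
      refine ⟨by omega, ?_, fun j hj => ?_⟩
      · rw [encoder, hunless, hst]
        exact (hcellpos (by norm_num)).congr h7
      · rcases j with _ | _ | j
        · rw [zero_add, encoder, hunless, hst]
          refine packWord_eq_of_testBit (((hcellpos (by norm_num)).congr h6).shl
            (val_wordSize.sub hprefix (by omega))) fun y hy => ?_
          rw [testBit_shortWord (by omega) hli hy, zero_mul, zero_add]
        · rw [encoder, hunless, hst]
          refine packWord_eq_of_testBit hzero fun y hy => ?_
          rw [padded_of_length_le (by omega), Nat.zero_testBit]
        · rw [encoder]
          · refine packWord_eq_of_testBit hzero fun y hy => ?_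
            have : w ≤ (j + 1 + 1) * w := Nat.le_mul_of_pos_left _ (by omega)
            rw [padded_of_length_le (by omega), Nat.zero_testBit]
          all_goals omega
    · have hst : ∀ x y : Expr, (ifStored x y).eval mem (encInit w i) = y.eval mem (encInit w i) :=
        fun x y => by
          rcases hgy : g (pos i) with _ | j
          · have h7 : col 7 (pos i) = 0 := by simp [hcol, tableColumn, hgy]
            rw [ifStored, (hcellpos (by norm_num)).iteEq_eq hzero h7]
          · have h7 : col 7 (pos i) = (code j).length := by simp [hcol, tableColumn, hgy]
            have h5 : col 5 (pos i) = j := by simp [hcol, tableColumn, hgy]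
            have h1 := hpos j
            have h2 : (j : ℕ) ≠ i := fun hji => hi (Fin.ext hji ▸ (hg _ _ hgy).1)
            rw [ifStored, (hcellpos (by norm_num)).iteEq_ne hzero (by omega),
              (hcellpos (by norm_num)).iteEq_ne hsym (by omega)]
      have h2w : 2 * w ≤ k * w := Nat.mul_le_mul_right _ hk
      refine ⟨by rw [hlenEsc i hi]; omega, ?_, fun j hj => ?_⟩
      · rw [encoder, hunless, hst, hlenEsc i hi]
        exact hesc
      · rw [hS' i hi]
        rcases j with _ | _ | j
        · rw [zero_add, encoder, hunless, hst]
          refine packWord_eq_of_testBit (((hheader (by norm_num)).shl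
            (val_wordSize.sub hel (by omega))).or ((hsym.shl hspare).shr hel)) fun y hy => ?_
          rw [zero_mul, zero_add, ← testBit_escapeFirstWord hbw (by omega) hy]
          rfl
        · rw [encoder, hunless, hst]
          refine packWord_eq_of_testBit ((hsym.shl hspare).shl
            (val_wordSize.sub hel (by omega))) fun y hy => ?_
          rw [zero_add, one_mul, ← testBit_escapeSecondWord hbw (by omega) hy]
        · rw [encoder]
          · refine packWord_eq_of_testBit hzero fun y hy => ?_
            have : 2 * w ≤ (j + 1 + 1) * w := Nat.mul_le_mul_right _ (by omega)
            rw [padded_of_length_le (by simp; omega), Nat.zero_testBit]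
          all_goals omega
  · intro i st hst
    have hr0 : Val mem (decInit w k st) (.reg 0) (packWord w st 0).toNat := by
      simp [Val, eval, decInit, show 0 < k by omega]
    have hr1 : Val mem (decInit w k st) (.reg 1) (packWord w st 1).toNat := by
      simp [Val, eval, decInit, show 1 < k by omega]
    set x := readBits st 0 m with hx
    have hxv : Val mem (decInit w k st) streamPrefix x := by
      refine (hr0.shr (val_wordSize.sub hprefix (by omega))).congr ?_
      have := shift_packWord (w := w) (r := 0) (b := m) st 0 (by omega)
      rw [pow_zero, mul_one, Nat.mod_eq_of_lt (BitVec.isLt _), zero_mul, zero_add] at this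
      exact this
    have hxlt : x < 2 ^ (m + 4) := (readBits_lt _ _ _).trans_le hpm
    have hcellx : ∀ {c : ℕ}, c < 8 →
        Val mem (decInit w k st) (cell c streamPrefix) (col c x) :=
      fun {c} hc8 => hcell hc8 hxlt hxv
    have hzero : Val mem (decInit w k st) (.const 0) 0 := val_const (by positivity)
    have hbits : ∀ j < m, x.testBit (m - 1 - j) = st j := fun j hj => by
      rw [hx, testBit_readBits]
      simp only [show m - 1 - j < m by omega, decide_true, Bool.true_and]
      congr 1
      omega
    -- The bits of the stream after the codeword are arbitrary, but the prefix property excludes any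
    -- other match.
    have hfound : ∀ j, f x = some j → j ∈ S ∧ j = i := fun j hj => by
      obtain ⟨h1, h2⟩ := hf x j hj
      refine ⟨h1, hc.eq_of_startsWith (s := st) (fun l hl => ?_) hst⟩
      rw [← h2 l hl]
      exact (hbits l (hl.trans_le (hS j h1))).symm
    by_cases hi : i ∈ S
    · have hfx : f x = some i := by
        rcases hfy : f x with _ | j
        · refine absurd ⟨hi, fun l hl => ?_⟩ (hf' x hfy i)
          simp only
          rw [hbits l (hl.trans_le (hS i hi)), hst l hl]
        · rw [(hfound j hfy).2]
      have h0 : col 0 x = i := by simp [hcol, tableColumn, hfx]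
      have h1 : col 1 x = (code i).length := by simp [hcol, tableColumn, hfx]
      have h2 := hpos i
      constructor
      · rw [decoder, hunless, (hcellx (by norm_num)).iteEq_ne hzero (by omega)]
        exact (hcellx (by norm_num)).congr h0
      · rw [decoder, hunless, (hcellx (by norm_num)).iteEq_ne hzero (by omega)]
        · exact (hcellx (by norm_num)).congr h1
        all_goals omega
    · have hfx : f x = none := by
        rcases hfy : f x with _ | j
        · rfl
        · obtain ⟨h1, h2⟩ := hfound j hfy
          exact absurd (h2 ▸ h1) hi
      have h1 : col 1 x = 0 := by simp [hcol, tableColumn, hfx]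
      constructor
      · rw [decoder, hunless, (hcellx (by norm_num)).iteEq_eq hzero h1]
        refine (((hr0.shl hel).or (hr1.shr (val_wordSize.sub hel (by omega)))).shr hspare).congr ?_
        rw [shift_or_packWord st (by omega) hbw]
        refine (eq_readBits (i.2.trans_le hb) fun y hy => ?_).symm
        rw [hst _ (by rw [hlenEsc i hi]; omega), hS' i hi, padded_append_right,
          padded_bitList (by omega)]
        congr 1
        omega
      · rw [decoder, hunless, (hcellx (by norm_num)).iteEq_eq hzero h1, hlenEsc i hi]
        · exact hesc
        all_goals omega

/-- A single symbol is encoded and decoded with empty memory. -/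
theorem encodesBy_decodesBy_nil {w l k : ℕ} (code : Fin 1 → List Bool) (hcode : ∀ i, code i = []) :
    EncodesBy w [] code k (encoder l) ∧ DecodesBy w [] code k (decoder l) := by
  have hmem : ∀ a, memory w [] a = 0 := fun a => by
    refine (packWord_eq_of_testBit (a := 0) (by simp) fun m _ => ?_).symm
    rw [padded_of_length_le (by simp), Nat.zero_testBit]
  have hun : ∀ (r : Regs w) (x : Expr), (unlessEmpty x).eval (memory w []) r = 0 := fun r x => by
    rw [unlessEmpty, eval_iteEq_of_eq]
    · simp [eval]
    · simp [firstWord, eval, hmem]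
  have hzero : ∀ j, (0 : BitVec w) = packWord w (padded []) j := fun j =>
    packWord_eq_of_testBit (a := 0) (by simp) fun m _ => by
      rw [padded_of_length_le (by simp), Nat.zero_testBit]
  refine ⟨fun i => ⟨by simp [hcode], ?_, fun j _ => ?_⟩, fun i s _ => ⟨?_, ?_⟩⟩
  · rw [encoder, hun]; simp [hcode]
  · rw [hcode, ← hzero]
    rcases j with _ | _ | j
    · rw [encoder, hun]
    · rw [encoder, hun]
    · rw [encoder]
      · simp [eval]
      all_goals omega
  · rw [decoder, hun]; simp
  · rw [decoder, hun]
    · simp [hcode]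
    all_goals omega

/-! ### Assembling the programs -/

theorem EncodesBy.congr {n w k : ℕ} {B : List Bool} {code : Fin n → List Bool} {E E' : ℕ → Expr}
    (h : EncodesBy w B code k E)
    (hE : ∀ j (mem : BitVec w → BitVec w) (r : Regs w), (E' j).eval mem r = (E j).eval mem r) :
    EncodesBy w B code k E' := fun i => by
  simpa only [hE] using h i

theorem DecodesBy.congr {n w k : ℕ} {B : List Bool} {code : Fin n → List Bool} {E E' : ℕ → Expr}
    (h : DecodesBy w B code k E)
    (hE : ∀ j (mem : BitVec w → BitVec w) (r : Regs w), (E' j).eval mem r = (E j).eval mem r) :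
    DecodesBy w B code k E' := fun i s hs => by
  simpa only [hE] using h i s hs

theorem exists_encoding_prog (k : ℕ) (E : ℕ → Expr) : ∃ (enc : Prog) (T : ℕ),
    ∀ (n w : ℕ) (B : List Bool) (code : Fin n → List Bool), EncodesBy w B code k E →
      EncodesWithin w B code enc k T := by
  obtain ⟨prog, T, h⟩ := Expr.exists_prog (k + 1) E
  refine ⟨prog, T, fun n w B code hE i => ?_⟩
  obtain ⟨h1, h2, h3⟩ := hE i
  obtain ⟨r, t, ht, hx, hr⟩ := h w (memory w B) (encInit w i)
  refine ⟨h1, r, t, ht, hx, ?_, fun j hj => ?_⟩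
  · rw [hr 0 (by omega), h2]
  · rw [hr (j + 1) (by omega), h3 j hj]

theorem exists_decoding_prog (k : ℕ) (E : ℕ → Expr) : ∃ (dec : Prog) (T : ℕ),
    ∀ (n w : ℕ) (B : List Bool) (code : Fin n → List Bool), DecodesBy w B code k E →
      DecodesWithin w B code dec k T := by
  obtain ⟨prog, T, h⟩ := Expr.exists_prog 2 E
  refine ⟨prog, T, fun n w B code hE i s hs => ?_⟩
  obtain ⟨h1, h2⟩ := hE i s hs
  obtain ⟨r, t, ht, hx, hr⟩ := h w (memory w B) (decInit w k s)
  refine ⟨r, t, ht, hx, ?_, ?_⟩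
  · rw [hr 0 (by omega), h1]
  · rw [hr 1 (by omega), h2]

theorem EncodesWithin.mono {n w k T T' : ℕ} {B : List Bool} {code : Fin n → List Bool}
    {enc : Prog} (h : EncodesWithin w B code enc k T) (hT : T ≤ T') :
    EncodesWithin w B code enc k T' := fun i => by
  obtain ⟨h1, r, t, ht, h2⟩ := h i
  exact ⟨h1, r, t, ht.trans hT, h2⟩

theorem DecodesWithin.mono {n w k T T' : ℕ} {B : List Bool} {code : Fin n → List Bool}
    {dec : Prog} (h : DecodesWithin w B code dec k T) (hT : T ≤ T') :
    DecodesWithin w B code dec k T' := fun i s hs => by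
  obtain ⟨r, t, ht, h2⟩ := h i s hs
  exact ⟨r, t, ht.trans hT, h2⟩

theorem avgLength_nonneg {n : ℕ} {p : Fin n → ℝ} (hp : ∀ i, 0 ≤ p i) (code : Fin n → List Bool) :
    0 ≤ avgLength p code :=
  Finset.sum_nonneg fun i _ => mul_nonneg (hp i) (Nat.cast_nonneg _)

/-! ### The constants -/

/-- Codewords of at least this length may grow by one bit. -/
noncomputable def growthLength (c : ℝ) : ℕ := ⌈1 / (c - 1)⌉₊

/-- Codewords longer than this are replaced, for fields of `b` bits. -/
noncomputable def cutLength (c : ℝ) (b : ℕ) : ℕ := ⌈((b : ℝ) + growthLength c + 1) / c⌉₊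

/-- From this word size on the table is used. -/
noncomputable def wordThreshold (c : ℝ) : ℕ :=
  -- The summands serve `cutLength_add_le`, `growthLength_le_cutLength` and the requirement that the
  -- escape word fit into a field, in this order.
  ⌈(growthLength c + 1 + 10 * c) / (c - 1)⌉₊ + ⌈c * growthLength c⌉₊ + growthLength c + 1

section Constants

variable {c : ℝ}

/-- This is the inequality `l + 1 ≤ c * l` for `l = growthLength c`, and it persists for larger `l`.
-/
theorem one_le_mul_growthLength (hc : 1 < c) : 1 ≤ (c - 1) * growthLength c := by
  have h1 : 0 < c - 1 := by linarith
  have := (div_le_iff₀ h1).1 (Nat.le_ceil (1 / (c - 1)))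
  rwa [mul_comm] at this

/-- The left side is the length of the escape word followed by a symbol, which replaces only
codewords longer than `cutLength c b`. -/
theorem le_mul_cutLength (hc : 1 < c) (b : ℕ) :
    (growthLength c : ℝ) + 1 + b ≤ c * cutLength c b := by
  have := (div_le_iff₀ (by linarith : 0 < c)).1 (Nat.le_ceil (((b : ℝ) + growthLength c + 1) / c))
  rw [cutLength]
  linarith

theorem cutLength_lt (hc : 1 < c) (b : ℕ) :
    (cutLength c b : ℝ) < ((b : ℝ) + growthLength c + 1) / c + 1 :=
  Nat.ceil_lt_add_one (div_nonneg (by positivity) (by linarith))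

theorem growthLength_lt_wordThreshold : growthLength c + 1 ≤ wordThreshold c := by
  rw [wordThreshold]; omega

/-- Since `c > 1`, the gap `b - b/c` grows with `b`. The `10` in the threshold is the `9` needed
here plus one for rounding up. -/
theorem cutLength_add_le (hc : 1 < c) {b : ℕ} (hb : wordThreshold c ≤ b) :
    cutLength c b + 1 + 8 ≤ b := by
  have hc0 : 0 < c := by linarith
  have h1 : 0 < c - 1 := by linarith
  have h2 : ((growthLength c : ℝ) + 1 + 10 * c) / (c - 1) ≤ b := by
    refine (Nat.le_ceil _).trans (Nat.cast_le.2 (le_trans ?_ hb))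
    rw [wordThreshold]; omega
  rw [div_le_iff₀ h1] at h2
  have h3 : ((b : ℝ) + growthLength c + 1) / c ≤ b - 10 := by
    rw [div_le_iff₀ hc0]; linarith
  have h4 : ((cutLength c b + 1 + 8 : ℕ) : ℝ) ≤ b := by
    have := cutLength_lt hc b
    push_cast
    linarith
  exact_mod_cast h4

theorem growthLength_le_cutLength (hc : 1 < c) {b : ℕ} (hb : wordThreshold c ≤ b) :
    growthLength c ≤ cutLength c b := by
  have hc0 : 0 < c := by linarith
  have h2 : c * growthLength c ≤ b := by
    refine (Nat.le_ceil _).trans (Nat.cast_le.2 (le_trans ?_ hb))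
    rw [wordThreshold]; omega
  have h3 := le_mul_cutLength hc b
  have h4 : c * (growthLength c : ℝ) ≤ c * cutLength c b := by
    have : (0 : ℝ) ≤ growthLength c := Nat.cast_nonneg _
    linarith
  exact_mod_cast le_of_mul_le_mul_left h4 hc0

/-- The constant factor of the size of the table. -/
noncomputable def sizeConstant (c : ℝ) : ℝ :=
  -- The factors after `411` come from `t+1 < (b+K+1)/c + 2`, from `2^b ≤ 2^W * n` and from `b ≤
  -- (W+2) * log₂ n`.
  411 * (4 * (2 : ℝ) ^ (((growthLength c : ℝ) + 1) / c) * ((2 : ℝ) ^ wordThreshold c) ^ (1 / c))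
    * (wordThreshold c + 2)

theorem one_le_logb {n : ℕ} (hn : 2 ≤ n) : 1 ≤ Real.logb 2 n := by
  rw [Real.le_logb_iff_rpow_le (by norm_num) (by positivity), Real.rpow_one]
  exact_mod_cast hn

/-- The size of the table is `O(n ^ (1 / c) * log n)`. -/
theorem table_size_le (hc : 1 < c) {n : ℕ} (hn : 2 ≤ n) :
    ((3 * (8 * (2 ^ (cutLength c (max (Nat.clog 2 n) (wordThreshold c)) + 1 + 4) + 1) + 1) *
      max (Nat.clog 2 n) (wordThreshold c) : ℕ) : ℝ)
      ≤ sizeConstant c * ((n : ℝ) ^ (1 / c) * Real.logb 2 n) := by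
  have hc0 : 0 < c := by linarith
  set W := wordThreshold c with hW
  set b := max (Nat.clog 2 n) W with hb
  set K := growthLength c with hK
  have hlog := one_le_logb hn
  have hclog : Nat.clog 2 n ≤ Real.logb 2 n + 1 := by
    have h1 : 1 < n := hn
    have h2 := Nat.pow_pred_clog_lt_self (b := 2) (by norm_num) h1
    have h3 : 0 < Nat.clog 2 n := Nat.clog_pos (by norm_num) h1
    have h4 : ((Nat.clog 2 n - 1 : ℕ) : ℝ) ≤ Real.logb 2 n := by
      rw [Real.le_logb_iff_rpow_le (by norm_num) (by positivity), Real.rpow_natCast]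
      exact_mod_cast h2.le
    rw [Nat.cast_sub h3] at h4
    push_cast at h4
    linarith
  have hblog : (b : ℝ) ≤ (W + 2) * Real.logb 2 n := by
    have hW0 : (0 : ℝ) ≤ W := Nat.cast_nonneg _
    rw [hb, Nat.cast_max]
    refine max_le ?_ ?_ <;> nlinarith
  have hpow : (2 : ℝ) ^ b ≤ 2 ^ W * n := by
    have hn' : (2 : ℝ) ≤ n := by exact_mod_cast hn
    have hW1 : (2 : ℝ) ≤ 2 ^ W := by
      calc (2 : ℝ) = 2 ^ 1 := by norm_num
        _ ≤ 2 ^ W := pow_le_pow_right₀ (by norm_num)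
            ((Nat.le_add_left _ _).trans growthLength_lt_wordThreshold)
    rcases max_cases (Nat.clog 2 n) W with ⟨h, -⟩ | ⟨h, -⟩
    · have h3 : 0 < Nat.clog 2 n := Nat.clog_pos (by norm_num) hn
      have h2 : (2 : ℝ) ^ (Nat.clog 2 n - 1) ≤ n := by
        exact_mod_cast (Nat.pow_pred_clog_lt_self (b := 2) (by norm_num) hn).le
      rw [hb, h, ← Nat.sub_add_cancel h3, pow_succ]
      nlinarith
    · rw [hb, h]
      nlinarith
  have htwo : (2 : ℝ) ^ (cutLength c b + 1)
      ≤ 4 * (2 : ℝ) ^ (((K : ℝ) + 1) / c) * ((2 : ℝ) ^ W) ^ (1 / c) * (n : ℝ) ^ (1 / c) := by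
    calc (2 : ℝ) ^ (cutLength c b + 1) = (2 : ℝ) ^ ((cutLength c b + 1 : ℕ) : ℝ) :=
          (Real.rpow_natCast _ _).symm
      _ ≤ (2 : ℝ) ^ (2 + ((K : ℝ) + 1) / c + b * (1 / c)) := by
          refine Real.rpow_le_rpow_of_exponent_le (by norm_num) ?_
          have h1 := cutLength_lt hc b
          have h2 : ((b : ℝ) + K + 1) / c = ((K : ℝ) + 1) / c + b * (1 / c) := by ring
          push_cast
          linarith
      _ = 4 * (2 : ℝ) ^ (((K : ℝ) + 1) / c) * ((2 : ℝ) ^ b) ^ (1 / c) := by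
          rw [Real.rpow_add (by norm_num), Real.rpow_add (by norm_num), Real.rpow_mul (by norm_num),
            Real.rpow_natCast]
          norm_num
      _ ≤ 4 * (2 : ℝ) ^ (((K : ℝ) + 1) / c) * ((2 : ℝ) ^ W * n) ^ (1 / c) := by
          gcongr
      _ = _ := by
          rw [Real.mul_rpow (by positivity) (by positivity)]
          ring
  have hone : (1 : ℝ) ≤ 2 ^ (cutLength c b + 1) := one_le_pow₀ (by norm_num)
  -- `3 * (8 * (16*X + 1) + 1) = 384*X + 27 ≤ 411*X` for `X = 2^(t+1) ≥ 1`.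
  have hcount : ((3 * (8 * (2 ^ (cutLength c b + 1 + 4) + 1) + 1) * b : ℕ) : ℝ)
      ≤ 411 * (2 : ℝ) ^ (cutLength c b + 1) * b := by
    push_cast
    refine mul_le_mul_of_nonneg_right ?_ (Nat.cast_nonneg b)
    rw [pow_add (2 : ℝ) (cutLength c b + 1) 4]
    linarith
  calc ((3 * (8 * (2 ^ (cutLength c b + 1 + 4) + 1) + 1) * b : ℕ) : ℝ)
      ≤ 411 * (2 : ℝ) ^ (cutLength c b + 1) * b := hcount
    _ ≤ 411 * (4 * (2 : ℝ) ^ (((K : ℝ) + 1) / c) * ((2 : ℝ) ^ W) ^ (1 / c) * (n : ℝ) ^ (1 / c))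
        * ((W + 2) * Real.logb 2 n) := by gcongr
    _ = sizeConstant c * ((n : ℝ) ^ (1 / c) * Real.logb 2 n) := by
        rw [sizeConstant]; ring

/-! ### The average length and the space at large word sizes -/

/-- The code for large word sizes. -/
theorem exists_code_of_wordThreshold_le (hc : 1 < c) {n w k : ℕ} (hn : 2 ≤ n) (hnw : n ≤ 2 ^ w)
    (hw : wordThreshold c ≤ w) (hk : 2 ≤ k) (p : Fin n → ℝ) (hp : ∀ i, 0 ≤ p i) :
    ∃ (code : Fin n → List Bool) (B : List Bool), IsPrefixCode code ∧
      avgLength p code ≤ c * optAvgLength p ∧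
      (B.length : ℝ) ≤ sizeConstant c * ((n : ℝ) ^ (1 / c) * Real.logb 2 n) ∧
      EncodesBy w B code k (Expr.encoder (growthLength c + 1)) ∧
      DecodesBy w B code k (Expr.decoder (growthLength c + 1)) := by
  set b := max (Nat.clog 2 n) (wordThreshold c) with hb
  have hWb : wordThreshold c ≤ b := le_max_right _ _
  have hbw : b ≤ w := max_le ((Nat.clog_le_iff_le_pow (by norm_num)).2 hnw) hw
  have hnb : n ≤ 2 ^ b := (Nat.clog_le_iff_le_pow (by norm_num)).1 (le_max_left _ _)
  obtain ⟨code₀, hpre₀, hopt, -⟩ := exists_optimal_code p hp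
  obtain ⟨code, S, e, hpre, he, hS, hS', hlen⟩ := hpre₀.exists_escape
    (growthLength_le_cutLength hc hWb) hnb
  obtain ⟨B, hB, hE, hD⟩ := exists_table hpre hn hnb hbw (cutLength_add_le hc hWb)
    (by rw [he]; exact growthLength_lt_wordThreshold.trans hWb) hk hS hS'
  rw [he] at hE hD
  refine ⟨code, B, hpre, ?_, (Nat.cast_le.2 hB).trans (table_size_le hc hn), hE, hD⟩
  rw [← hopt, avgLength, avgLength, Finset.mul_sum]
  refine Finset.sum_le_sum fun i _ => ?_
  -- The factor `c` holds for each codeword separately, whatever the weights are.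
  have hi : ((code i).length : ℝ) ≤ c * (code₀ i).length := by
    have h0 : (0 : ℝ) ≤ (code₀ i).length := Nat.cast_nonneg _
    rcases hlen i with h | ⟨h1, h2⟩ | ⟨h1, h2⟩
    · have h' : ((code i).length : ℝ) ≤ (code₀ i).length := Nat.cast_le.2 h
      nlinarith
    · have h1' : (growthLength c : ℝ) ≤ (code₀ i).length := Nat.cast_le.2 h1
      have h2' : ((code i).length : ℝ) ≤ (code₀ i).length + 1 := by exact_mod_cast h2
      have := one_le_mul_growthLength hc
      nlinarith
    · have h1' : (cutLength c b : ℝ) ≤ (code₀ i).length := Nat.cast_le.2 h1.le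
      have := le_mul_cutLength hc b
      rw [h2]
      push_cast
      nlinarith
  calc p i * ((code i).length : ℝ) ≤ p i * (c * (code₀ i).length) :=
        mul_le_mul_of_nonneg_left hi (hp i)
    _ = c * (p i * (code₀ i).length) := by ring

end Constants

end PrefixCodeRAM

/-! ### Combination of small and large word sizes -/

open PrefixCodeRAM

theorem mainTheorem4 (c : ℝ) (hc : 1 < c) :
    ∃ (enc dec : PrefixCodeRAM.Prog) (k T : ℕ) (C : ℝ),
      ∀ (n w : ℕ), n ≤ 2 ^ w →
      ∀ p : Fin n → ℝ, (∀ i, 0 ≤ p i) → ∑ i, p i = 1 →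
        ∃ (code : Fin n → List Bool) (B : List Bool),
          PrefixCodeRAM.IsPrefixCode code ∧
          PrefixCodeRAM.avgLength p code ≤ c * PrefixCodeRAM.optAvgLength p ∧
          (B.length : ℝ) ≤ C * ((n : ℝ) ^ (1 / c) * Real.logb 2 n) ∧
          PrefixCodeRAM.EncodesWithin w B code enc k T ∧
          PrefixCodeRAM.DecodesWithin w B code dec k T := by
  set W := wordThreshold c with hW
  have hW1 : 1 ≤ W := (Nat.le_add_left _ _).trans growthLength_lt_wordThreshold
  -- At small word sizes codewords have fewer than `n ≤ 2^w ≤ k` bits; at large ones two words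
  -- suffice.
  set k := 2 ^ W with hk
  have hk2 : 2 ≤ k := by
    calc 2 = 2 ^ 1 := rfl
      _ ≤ 2 ^ W := Nat.pow_le_pow_right (by norm_num) hW1
  have hsmall : ∀ w, ∃ E D : ℕ → Expr, w < W → ∀ n : ℕ, 1 ≤ n → n ≤ 2 ^ w →
      ∀ p : Fin n → ℝ, (∀ i, 0 ≤ p i) →
      ∃ (code : Fin n → List Bool) (B : List Bool), IsPrefixCode code ∧
        avgLength p code = optAvgLength p ∧ B.length ≤ 2 ^ w * w ∧ (n = 1 → B = []) ∧
        EncodesBy w B code k E ∧ DecodesBy w B code k D := fun w => by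
    by_cases hw : w < W
    · obtain ⟨E, D, h⟩ := exists_expr_of_wordSize w k (Nat.pow_le_pow_right (by norm_num) hw.le)
      exact ⟨E, D, fun _ => h⟩
    · exact ⟨fun _ => .const 0, fun _ => .const 0, fun h => absurd h hw⟩
  choose E D hED using hsmall
  choose E' hE' using fun j =>
    Expr.exists_dispatch W (fun w => E w j) (Expr.encoder (growthLength c + 1) j)
  choose D' hD' using fun j =>
    Expr.exists_dispatch W (fun w => D w j) (Expr.decoder (growthLength c + 1) j)
  obtain ⟨enc, T₁, henc⟩ := exists_encoding_prog k E'
  obtain ⟨dec, T₂, hdec⟩ := exists_decoding_prog k D'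
  have hsize : 0 ≤ sizeConstant c := by
    rw [sizeConstant]; positivity
  refine ⟨enc, dec, k, max T₁ T₂, sizeConstant c + (2 ^ W * W : ℕ), fun n w hnw p hp hsum => ?_⟩
  suffices h : ∃ (code : Fin n → List Bool) (B : List Bool), IsPrefixCode code ∧
      avgLength p code ≤ c * optAvgLength p ∧
      (B.length : ℝ) ≤ (sizeConstant c + (2 ^ W * W : ℕ)) * ((n : ℝ) ^ (1 / c) * Real.logb 2 n) ∧
      EncodesBy w B code k E' ∧ DecodesBy w B code k D' by
    obtain ⟨code, B, h1, h2, h3, h4, h5⟩ := h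
    exact ⟨code, B, h1, h2, h3, (henc n w B code h4).mono (le_max_left _ _),
      (hdec n w B code h5).mono (le_max_right _ _)⟩
  have hn1 : 1 ≤ n := by
    by_contra! h
    obtain rfl : n = 0 := by omega
    simp at hsum
  -- For `n ≥ 2` a constant number of bits is within the bound. For `n = 1` the bound is zero, and
  -- the string has to be empty.
  have hfactor : 2 ≤ n → 1 ≤ (n : ℝ) ^ (1 / c) * Real.logb 2 n := fun hn =>
    one_le_mul_of_one_le_of_one_le (Real.one_le_rpow (by exact_mod_cast hn1) (by positivity))
      (one_le_logb hn)
  by_cases hw : w < W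
  · obtain ⟨code, B, h1, h2, h3, h4, h5, h6⟩ := hED w hw n hn1 hnw p hp
    refine ⟨code, B, h1, ?_, ?_, h5.congr fun j mem r => by rw [hE', if_pos hw],
      h6.congr fun j mem r => by rw [hD', if_pos hw]⟩
    · rw [← h2]
      have := avgLength_nonneg hp code
      nlinarith
    · rcases hn1.eq_or_lt with hn | hn
      · rw [h4 hn.symm, ← hn]
        simp
      · have h7 : (B.length : ℝ) ≤ ((2 ^ W * W : ℕ) : ℝ) := Nat.cast_le.2
          (h3.trans (Nat.mul_le_mul (Nat.pow_le_pow_right (by norm_num) hw.le) hw.le))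
        have h8 := hfactor hn
        have h9 : (0 : ℝ) ≤ ((2 ^ W * W : ℕ) : ℝ) := Nat.cast_nonneg _
        nlinarith
  · rcases hn1.eq_or_lt with hn | hn
    · subst hn
      obtain ⟨h1, h2⟩ := encodesBy_decodesBy_nil (w := w) (l := growthLength c + 1) (k := k)
        (fun _ => []) fun _ => rfl
      obtain ⟨code₀, -, hopt, -⟩ := exists_optimal_code p hp
      refine ⟨_, [], fun i j hij => absurd (Subsingleton.elim i j) hij, ?_, by simp,
        h1.congr fun j mem r => by rw [hE', if_neg hw],
        h2.congr fun j mem r => by rw [hD', if_neg hw]⟩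
      rw [← hopt]
      have := mul_nonneg (zero_le_one.trans hc.le) (avgLength_nonneg hp code₀)
      simpa [avgLength] using this
    · obtain ⟨code, B, h1, h2, h3, h4, h5⟩ :=
        exists_code_of_wordThreshold_le hc hn hnw (not_lt.1 hw) hk2 p hp
      refine ⟨code, B, h1, h2, h3.trans ?_, h4.congr fun j mem r => by rw [hE', if_neg hw],
        h5.congr fun j mem r => by rw [hD', if_neg hw]⟩
      have h8 := hfactor hn
      have h9 : (0 : ℝ) ≤ ((2 ^ W * W : ℕ) : ℝ) := Nat.cast_nonneg _
      nlinarith
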